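/- Let $M$ be a smooth real supermanifold, let $T^*M$ be its cotangent bundle with natural local coordinates $(x^A,p_A)$, where $p_A$ has the parity $\widetilde A$ of $x^A$, and let $$\{F,G\}=(-1)^{\widetilde A\widetilde F+\widetilde A}\frac{\partial F}{\partial p_A}\frac{\partial G}{\partial x^A}-(-1)^{\widetilde A\widetilde F}\frac{\partial F}{\partial x^A}\frac{\partial G}{\partial p_A}$$ be the canonical Poisson bracket on $C^\infty(T^*M)$. The symbol of a vector field $X=X^A\partial/\partial x^A$ on $M$ is $\mathcal X=X^Ap_A\in C^\infty(T^*M)$, and $L_XF:=\{\mathcal X,F\}$ for $F\in C^\infty(T^*M)$. An odd Jacobi structure on $M$ is a pair $(S,Q)$ of an odd function $S\in C^\infty(T^*M)$ of degree two in the fibre coordinates and an odd vector field $Q$ on $M$ such that $Q^2=0$, $L_QS=0$ and $\{S,S\}=-2\mathcal Q S$. A QS structure on $M$ is a pair $(\widehat S,\widehat Q)$ of the same kind such that $\widehat Q^2=0$, $L_{\widehat Q}\widehat S=0$ and $\{\widehat S,\widehat S\}=0$; it is exact, with homothety vector field $E$, if $E$ is an even vector field on $M$ with $L_E\widehat S=-\widehat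 S$ and $[E,\widehat Q]=-\widehat Q$. Let $(\widehat S,\widehat Q)$ be an exact QS structure on $M$ with homothety vector field $E$. Then for all real numbers $a,b$ the pair $$S=a\,\widehat S+b\,\mathcal E\,\widehat{\mathcal Q},\qquad Q=b\,\widehat Q$$ is an odd Jacobi structure on $M$. More generally, the same holds for even parameters $a,b$, that is, for elements $a,b$ of a commutative $\mathbb R$-algebra $B$ (such as the even part of an auxiliary Grassmann algebra), where functions and vector fields are allowed to depend on the parameters (their local expressions have coefficients in $B$) and all operations are extended $B$-linearly. In particular, for real $a$ and $b$: if $b=0$, one obtains the Schouten structure $a\widehat S$ (so $\{a\widehat S,a\widehat S\}=0$), viewed as the odd Jacobi structure $(a\widehat S,0)$; if $a=0$, one obtains the odd Jacobi structure $(b\,\mathcal E\widehat{\mathcal Q},\,b\widehat Q)$, built from the homological vector field $b\widehat Q$ and $E$ alone; if $a=b=1$, one obtains the odd Jacobi structure $(\widehat S+\mathcal E\widehat{\mathcal Q},\,\widehat Q)$. -/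

import Mathlib

universe u v

open scoped TensorProduct ContDiff
open TopologicalSpace

noncomputable section

namespace OddJacobi

/-! ### Superdomains -/

section Domain

variable {ι κ ι' κ' : Type}

/-- Extension by zero of a function on an open subset of `ℝ^ι`. -/
def extendZero {U : Opens (ι → ℝ)} (f : U → ℝ) : (ι → ℝ) → ℝ :=
  Function.extend Subtype.val f 0

theorem extendZero_apply {U : Opens (ι → ℝ)} (f : U → ℝ) {x : ι → ℝ} (hx : x ∈ U) :
    extendZero f x = f ⟨x, hx⟩ :=
  Subtype.val_injective.extend_apply f 0 (⟨x, hx⟩ : U)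

variable [Fintype ι] [Fintype ι']

/-- `C^∞(U)`, the algebra of smooth real functions on an open set `U ⊆ ℝ^ι`. -/
def Smooth (U : Opens (ι → ℝ)) : Subalgebra ℝ (U → ℝ) where
  carrier := {f | ContDiffOn ℝ ∞ (extendZero f) U}
  mul_mem' {f g} hf hg := (ContDiffOn.mul hf hg).congr fun x hx => by
    simp [extendZero_apply _ (show x ∈ U from hx)]
  add_mem' {f g} hf hg := (ContDiffOn.add hf hg).congr fun x hx => by
    simp [extendZero_apply _ (show x ∈ U from hx)]
  algebraMap_mem' r := (contDiffOn_const (c := r)).congr fun x hx => by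
    simp [extendZero_apply _ (show x ∈ U from hx)]

theorem smooth_contDiffAt {U : Opens (ι → ℝ)} (f : Smooth U) {x : ι → ℝ} (hx : x ∈ U) :
    ContDiffAt ℝ ∞ (extendZero f.1) x :=
  (f.2 : ContDiffOn ℝ ∞ (extendZero f.1) U).contDiffAt (U.isOpen.mem_nhds hx)

variable [DecidableEq ι] [DecidableEq κ]

/-- The partial derivative `∂/∂x^a` on `C^∞(U)`. -/
def Smooth.partialDeriv {U : Opens (ι → ℝ)} (a : ι) : Smooth U →ₗ[ℝ] Smooth U where
  toFun f := ⟨fun x => fderiv ℝ (extendZero f.1) x (Pi.single a 1), by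
    have h : ContDiffOn ℝ ∞ (fun x => fderiv ℝ (extendZero f.1) x (Pi.single a 1)) U :=
      ((f.2 : ContDiffOn ℝ ∞ (extendZero f.1) U).fderiv_of_isOpen U.isOpen
        (by simp)).clm_apply contDiffOn_const
    exact h.congr fun x hx => extendZero_apply _ hx⟩
  map_add' f g := by
    ext x
    have hf := (smooth_contDiffAt f x.2).differentiableAt (by simp)
    have hg := (smooth_contDiffAt g x.2).differentiableAt (by simp)
    have : extendZero (f + g).1 =ᶠ[nhds x.1] extendZero f.1 + extendZero g.1 := by
      filter_upwards [U.isOpen.mem_nhds x.2] with y hy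
      simp [extendZero_apply _ (show y ∈ U from hy)]
    change fderiv ℝ (extendZero (f + g).1) x.1 _ = fderiv ℝ (extendZero f.1) x.1 _
      + fderiv ℝ (extendZero g.1) x.1 _
    rw [this.fderiv_eq, fderiv_add hf hg]
    rfl
  map_smul' r f := by
    ext x
    have hf := (smooth_contDiffAt f x.2).differentiableAt (by simp)
    have : extendZero (r • f).1 =ᶠ[nhds x.1] r • extendZero f.1 := by
      filter_upwards [U.isOpen.mem_nhds x.2] with y hy
      simp [extendZero_apply _ (show y ∈ U from hy)]
    change fderiv ℝ (extendZero (r • f).1) x.1 _ = r • fderiv ℝ (extendZero f.1) x.1 _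
    rw [this.fderiv_eq, fderiv_const_smul hf]
    rfl

/-- Pull-back `f ↦ f ∘ g` of smooth functions along a smooth map `g` taking `V` into `U`. -/
def Smooth.pullback {U : Opens (ι → ℝ)} {V : Opens (ι' → ℝ)} (g : (ι' → ℝ) → (ι → ℝ))
    (hg : ContDiff ℝ ∞ g) (hVU : ∀ x ∈ V, g x ∈ U) : Smooth U →ₐ[ℝ] Smooth V where
  toFun f := ⟨fun x => f.1 ⟨g x.1, hVU x.1 x.2⟩, by
    have h : ContDiffOn ℝ ∞ (extendZero f.1 ∘ g) V :=
      (f.2 : ContDiffOn ℝ ∞ (extendZero f.1) U).comp hg.contDiffOn hVU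
    exact h.congr fun x hx => by
      rw [extendZero_apply _ hx, Function.comp_apply, extendZero_apply _ (hVU x hx)]⟩
  map_one' := rfl
  map_mul' _ _ := rfl
  map_zero' := rfl
  map_add' _ _ := rfl
  commutes' _ := rfl

/-- The Grassmann algebra on the generators `ξ^j`, `j : κ`. -/
abbrev Grassmann (κ : Type) : Type := ExteriorAlgebra ℝ (κ → ℝ)

/-- Superfunctions `C^∞(U) ⊗ Λ(ξ^j : j ∈ κ)` on the superdomain with body `U` and odd
coordinates indexed by `κ`. -/
def SF (U : Opens (ι → ℝ)) (κ : Type) : Type := Smooth U ⊗[ℝ] Grassmann κ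

instance (U : Opens (ι → ℝ)) (κ : Type) : Ring (SF U κ) :=
  inferInstanceAs (Ring (Smooth U ⊗[ℝ] Grassmann κ))

instance (U : Opens (ι → ℝ)) (κ : Type) : Algebra ℝ (SF U κ) :=
  inferInstanceAs (Algebra ℝ (Smooth U ⊗[ℝ] Grassmann κ))

/-- The coordinate functions: even `x^a` for `inl a`, odd `ξ^j` for `inr j`. -/
def SF.coord {U : Opens (ι → ℝ)} : ι ⊕ κ → SF U κ
  | .inl a => ((⟨fun x => x.1 a, (contDiff_apply ℝ ℝ a).contDiffOn.congr fun _ hx =>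
      extendZero_apply _ hx⟩ : Smooth U) ⊗ₜ 1 : Smooth U ⊗[ℝ] Grassmann κ)
  | .inr j => (1 ⊗ₜ ExteriorAlgebra.ι ℝ (Pi.single j 1) : Smooth U ⊗[ℝ] Grassmann κ)

/-- The parity automorphism: `+1` on even and `-1` on odd superfunctions. -/
def SF.inv {U : Opens (ι → ℝ)} : SF U κ →ₐ[ℝ] SF U κ :=
  (Algebra.TensorProduct.map (AlgHom.id ℝ _) CliffordAlgebra.involute :
    Smooth U ⊗[ℝ] Grassmann κ →ₐ[ℝ] Smooth U ⊗[ℝ] Grassmann κ)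

/-- The (left) partial derivatives with respect to the coordinates; for an odd coordinate this is
the left contraction on the Grassmann algebra, the odd derivation with `∂_j ξ^k = δ_j^k`. -/
def SF.partialDeriv {U : Opens (ι → ℝ)} : ι ⊕ κ → SF U κ →ₗ[ℝ] SF U κ
  | .inl a => (LinearMap.rTensor (Grassmann κ) (Smooth.partialDeriv a) :
      Smooth U ⊗[ℝ] Grassmann κ →ₗ[ℝ] Smooth U ⊗[ℝ] Grassmann κ)
  | .inr j => (LinearMap.lTensor (Smooth U) (CliffordAlgebra.contractLeft (LinearMap.proj j)) :
      Smooth U ⊗[ℝ] Grassmann κ →ₗ[ℝ] Smooth U ⊗[ℝ] Grassmann κ)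

/-- Restriction of superfunctions to a smaller open set. -/
def SF.res {U V : Opens (ι → ℝ)} (h : V ≤ U) : SF U κ →ₐ[ℝ] SF V κ :=
  (Algebra.TensorProduct.map (Smooth.pullback id contDiff_id fun _ hx => h hx) (AlgHom.id ℝ _) :
    Smooth U ⊗[ℝ] Grassmann κ →ₐ[ℝ] Smooth V ⊗[ℝ] Grassmann κ)

/-! ### The cotangent bundle of a superdomain

Its even coordinates are indexed by `ι ⊕ ι` (first positions, then momenta), its odd coordinates by
`κ ⊕ κ`. -/

/-- The body `U × ℝ^ι` of the cotangent bundle of a superdomain with body `U`. -/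
def cot (U : Opens (ι → ℝ)) : Opens (ι ⊕ ι → ℝ) :=
  ⟨{z | (fun a => z (.inl a)) ∈ U}, U.isOpen.preimage (by fun_prop)⟩

theorem cot_mono {U V : Opens (ι → ℝ)} (h : V ≤ U) : cot V ≤ cot U := fun _ hz => h hz

/-- The index of the position coordinate `x^A` on the cotangent bundle. -/
def posIdx : ι ⊕ κ → (ι ⊕ ι) ⊕ (κ ⊕ κ) := Sum.map .inl .inl

/-- The index of the momentum coordinate `p_A`, which has the parity of `x^A`. -/
def momIdx : ι ⊕ κ → (ι ⊕ ι) ⊕ (κ ⊕ κ) := Sum.map .inr .inr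

/-- Superfunctions on the cotangent bundle of a superdomain. -/
abbrev CSF (U : Opens (ι → ℝ)) (κ : Type) : Type := SF (cot U) (κ ⊕ κ)

/-- Pull-back of superfunctions along the projection of the cotangent bundle. -/
def SF.lift {U : Opens (ι → ℝ)} : SF U κ →ₐ[ℝ] CSF U κ :=
  (Algebra.TensorProduct.map
    (Smooth.pullback (fun z a => z (.inl a)) (by fun_prop) fun _ hz => hz)
    (ExteriorAlgebra.map
      { toFun := fun v => (Sum.elim v 0 : κ ⊕ κ → ℝ)
        map_add' := fun v w => by ext (j | j) <;> simp
        map_smul' := fun r v => by ext (j | j) <;> simp }) :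
    Smooth U ⊗[ℝ] Grassmann κ →ₐ[ℝ] Smooth (cot U) ⊗[ℝ] Grassmann (κ ⊕ κ))

/-- The parity of the coordinate with index `A` (`0` for even, `1` for odd). -/
def deg : ι ⊕ κ → ℕ := Sum.elim (fun _ => 0) (fun _ => 1)

/-! ### Even parameters

`B` is a commutative `ℝ`-algebra of even parameters (such as the even part of a Grassmann algebra of
auxiliary parameters). Functions depending on the parameters form `B ⊗ SF U κ`; for `B = ℝ` this is
just `SF U κ`. All operations are extended `B`-linearly. -/

variable [Fintype κ] (B : Type v) [CommRing B] [Algebra ℝ B]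

/-- Superfunctions with even parameters from `B`. -/
def PSF (U : Opens (ι → ℝ)) (κ : Type) : Type v := B ⊗[ℝ] SF U κ

instance (U : Opens (ι → ℝ)) (κ : Type) : Ring (PSF B U κ) :=
  inferInstanceAs (Ring (B ⊗[ℝ] SF U κ))

instance (U : Opens (ι → ℝ)) (κ : Type) : Algebra B (PSF B U κ) :=
  inferInstanceAs (Algebra B (B ⊗[ℝ] SF U κ))

variable {B}

/-- The `B`-linear extension of an algebra homomorphism between superfunctions. -/
def PSF.map {U : Opens (ι → ℝ)} {V : Opens (ι' → ℝ)} (φ : SF U κ →ₐ[ℝ] SF V κ') :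
    PSF B U κ →ₐ[B] PSF B V κ' :=
  (Algebra.TensorProduct.map (AlgHom.id B B) φ : B ⊗[ℝ] SF U κ →ₐ[B] B ⊗[ℝ] SF V κ')

/-- A superfunction, regarded as one that does not depend on the parameters. -/
def PSF.const {U : Opens (ι → ℝ)} (f : SF U κ) : PSF B U κ := (1 ⊗ₜ f : B ⊗[ℝ] SF U κ)

/-- Extension of parameters from `ℝ` (no parameters) to `B`. -/
def PSF.extend (B : Type v) [CommRing B] [Algebra ℝ B] {U : Opens (ι → ℝ)} (f : PSF ℝ U κ) :
    PSF B U κ :=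
  (Algebra.TensorProduct.map (Algebra.ofId ℝ B) (AlgHom.id ℝ (SF U κ)) :
    ℝ ⊗[ℝ] SF U κ →ₐ[ℝ] B ⊗[ℝ] SF U κ) f

/-- The partial derivatives. -/
def PSF.partialDeriv {U : Opens (ι → ℝ)} (A : ι ⊕ κ) : PSF B U κ →ₗ[B] PSF B U κ :=
  ((SF.partialDeriv A).baseChange B : B ⊗[ℝ] SF U κ →ₗ[B] B ⊗[ℝ] SF U κ)

/-- `F` is homogeneous of parity `n` mod 2. -/
def PSF.HasParity {U : Opens (ι → ℝ)} (n : ℕ) (F : PSF B U κ) : Prop :=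
  PSF.map SF.inv F = (-1 : B) ^ n • F

/-- `(-1)^{|A||F|} F` for the coordinate index `A`, extended linearly to all `F`. -/
def PSF.twist {U : Opens (ι → ℝ)} {α : Type} {β : Type} (A : α ⊕ β) (F : PSF B U κ) :
    PSF B U κ :=
  Sum.elim (fun _ => F) (fun _ => PSF.map SF.inv F) A

/-- The momentum coordinate `p_A`. -/
def mom {U : Opens (ι → ℝ)} (A : ι ⊕ κ) : PSF B (cot U) (κ ⊕ κ) :=
  PSF.const (SF.coord (momIdx A))

/-- The canonical Poisson bracket
`{F,G} = (-1)^{|A||F|+|A|} ∂F/∂p_A ∂G/∂x^A - (-1)^{|A||F|} ∂F/∂x^A ∂G/∂p_A` (summed over `A`). -/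
def poisson {U : Opens (ι → ℝ)} (F G : PSF B (cot U) (κ ⊕ κ)) : PSF B (cot U) (κ ⊕ κ) :=
  ∑ A : ι ⊕ κ,
    ((-1 : B) ^ deg A • (PSF.partialDeriv (momIdx A) (PSF.twist A F) *
        PSF.partialDeriv (posIdx A) G)
      - PSF.partialDeriv (posIdx A) (PSF.twist A F) * PSF.partialDeriv (momIdx A) G)

/-- The operator `X^A ∂/∂x^A` on functions, for the vector field with components `X^A`. -/
def act {U : Opens (ι → ℝ)} (X : ι ⊕ κ → PSF B U κ) (f : PSF B U κ) : PSF B U κ :=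
  ∑ A, X A * PSF.partialDeriv A f

/-- The symbol `X^A p_A` of the vector field with components `X^A`. -/
def symb {U : Opens (ι → ℝ)} (X : ι ⊕ κ → PSF B U κ) : PSF B (cot U) (κ ⊕ κ) :=
  ∑ A : ι ⊕ κ, PSF.map SF.lift (X A) * mom A

/-- `F` is homogeneous of degree two in the fibre coordinates: `F = F^{AC}(x) p_A p_C`. -/
def DegreeTwo {U : Opens (ι → ℝ)} (F : PSF B (cot U) (κ ⊕ κ)) : Prop :=
  ∃ f : ι ⊕ κ → ι ⊕ κ → PSF B U κ, F =
    ∑ A : ι ⊕ κ, ∑ C : ι ⊕ κ, PSF.map SF.lift (f A C) * (mom A * mom C)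

/-- `Ψ` is the cotangent lift of the change of coordinates `ψ`, which expresses functions of the
coordinates `y` on `V` through the coordinates `x` on `U`: it extends `ψ` and
`Ψ (q_A) = (∂x^C/∂y^A) p_C` for the momenta `q`, `p` conjugate to `y`, `x`. -/
def IsCotangentLift {U V : Opens (ι → ℝ)} (ψ : SF V κ ≃ₐ[ℝ] SF U κ)
    (Ψ : CSF V κ →ₐ[ℝ] CSF U κ) : Prop :=
  (∀ f, Ψ (SF.lift f) = SF.lift (ψ f)) ∧
  ∀ A : ι ⊕ κ, Ψ (SF.coord (momIdx A)) =
    ∑ C : ι ⊕ κ, SF.lift (ψ (SF.partialDeriv A (ψ.symm (SF.coord C)))) * SF.coord (momIdx C)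

end Domain

/-! ### Supermanifolds -/

/-- A topological space with a sheaf of `ℤ/2`-graded supercommutative real algebras. -/
structure SuperSpace where
  X : TopCat.{u}
  sheaf : TopCat.Sheaf (AlgCat.{u} ℝ) X
  parity : ∀ W : Opens X, ZMod 2 → Submodule ℝ (sheaf.presheaf.obj (.op W))
  parity_internal : ∀ W, DirectSum.IsInternal (parity W)
  parity_one : ∀ W, (1 : sheaf.presheaf.obj (.op W)) ∈ parity W 0
  parity_mul : ∀ W i j, ∀ f ∈ parity W i, ∀ g ∈ parity W j, f * g ∈ parity W (i + j)
  supercomm : ∀ W i j, ∀ f ∈ parity W i, ∀ g ∈ parity W j,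
    f * g = (-1 : ℝ) ^ (i.val * j.val) • (g * f)
  parity_res : ∀ {V W : Opens X} (h : V ≤ W) (i), ∀ f ∈ parity W i,
    (sheaf.presheaf.map (CategoryTheory.homOfLE h).op).hom f ∈ parity V i

/-- The sections of the structure sheaf over an open set. -/
abbrev SuperSpace.Sec (M : SuperSpace.{u}) (W : Opens M.X) : Type u :=
  M.sheaf.presheaf.obj (.op W)

/-- Restriction of sections. -/
def SuperSpace.res (M : SuperSpace.{u}) {V W : Opens M.X} (h : V ≤ W) :
    M.Sec W →ₐ[ℝ] M.Sec V :=
  (M.sheaf.presheaf.map (CategoryTheory.homOfLE h).op).hom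

/-- The open subset of the model space corresponding to `W` in a chart. -/
def image {X : Type u} [TopologicalSpace X] {p : ℕ} (e : OpenPartialHomeomorph X (Fin p → ℝ))
    (W : Opens X) : Opens (Fin p → ℝ) :=
  ⟨e.target ∩ e.symm ⁻¹' W, e.isOpen_inter_preimage_symm W.isOpen⟩

theorem image_mono {X : Type u} [TopologicalSpace X] {p : ℕ}
    (e : OpenPartialHomeomorph X (Fin p → ℝ)) {V W : Opens X} (h : V ≤ W) :
    image e V ≤ image e W :=
  fun _ hx => ⟨hx.1, h hx.2⟩

/-- A chart of dimension `p|q`: an isomorphism of an open piece of the space, with its structure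
sheaf, onto an open piece of the superdomain `ℝ^{p|q}`. -/
structure Chart (M : SuperSpace.{u}) (p q : ℕ) where
  homeo : OpenPartialHomeomorph M.X (Fin p → ℝ)
  iso : ∀ W : Opens M.X, (W : Set M.X) ⊆ homeo.source → M.Sec W ≃ₐ[ℝ] SF (image homeo W) (Fin q)
  iso_res : ∀ (V W : Opens M.X) (h : V ≤ W) (hW : (W : Set M.X) ⊆ homeo.source) (f : M.Sec W),
    iso V (fun _ hx => hW (h hx)) (M.res h f) = SF.res (image_mono homeo h) (iso W hW f)
  iso_parity : ∀ (W : Opens M.X) (hW : (W : Set M.X) ⊆ homeo.source) (i : ZMod 2) (f : M.Sec W),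
    f ∈ M.parity W i ↔ SF.inv (iso W hW f) = (-1 : ℝ) ^ i.val • iso W hW f

/-- A smooth real supermanifold of dimension `p|q`. -/
structure Supermanifold (p q : ℕ) extends SuperSpace.{u} where
  t2 : T2Space X
  secondCountable : SecondCountableTopology X
  exists_chart : ∀ x : X, ∃ c : Chart toSuperSpace p q, x ∈ c.homeo.source

section Global

variable {p q : ℕ}

/-- The charts of a supermanifold (its maximal atlas). -/
abbrev Supermanifold.Charts (M : Supermanifold.{u} p q) : Type u := Chart M.toSuperSpace p q

variable {M : Supermanifold.{u} p q}

/-- The domain of a chart. -/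
def dom (c : M.Charts) : Opens M.X := ⟨c.homeo.source, c.homeo.open_source⟩

/-- The range of a chart. -/
abbrev ran (c : M.Charts) : Opens (Fin p → ℝ) := image c.homeo (dom c)

/-- The range, under the chart `c`, of the overlap of `c` and `d`. -/
abbrev overlap (c d : M.Charts) : Opens (Fin p → ℝ) := image c.homeo (dom c ⊓ dom d)

theorem overlap_le_left (c d : M.Charts) : overlap c d ≤ ran c := image_mono _ inf_le_left

theorem overlap_le_right (c d : M.Charts) : image d.homeo (dom c ⊓ dom d) ≤ ran d :=
  image_mono _ inf_le_right

/-- The change of coordinates from the chart `d` to the chart `c` on their overlap. -/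
def transition (c d : M.Charts) :
    SF (image d.homeo (dom c ⊓ dom d)) (Fin q) ≃ₐ[ℝ] SF (overlap c d) (Fin q) :=
  (d.iso (dom c ⊓ dom d) fun _ hx => hx.2).symm.trans (c.iso (dom c ⊓ dom d) fun _ hx => hx.1)

variable (B : Type v) [CommRing B] [Algebra ℝ B]

/-! A function on the cotangent bundle, or a vector field, is given by its local expressions in all
charts, subject to the transformation law. -/

/-- Families, indexed by the charts, of functions on the cotangent bundles of the chart ranges; an
algebra over `B` under the chartwise operations. -/
abbrev CotFamily (M : Supermanifold.{u} p q) : Type (max u v) :=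
  ∀ c : M.Charts, PSF B (cot (ran c)) (Fin q ⊕ Fin q)

/-- Families, indexed by the charts, of components of vector fields; a `B`-module under the
chartwise operations. -/
abbrev VecFamily (M : Supermanifold.{u} p q) : Type (max u v) :=
  ∀ c : M.Charts, Fin p ⊕ Fin q → PSF B (ran c) (Fin q)

variable {B}

/-- The family is a function in `C^∞(T*M)`: the local expressions agree on overlaps. -/
def IsCotFunction (F : CotFamily B M) : Prop :=
  ∀ c d : M.Charts, ∃ Ψ : CSF (image d.homeo (dom c ⊓ dom d)) (Fin q) →ₐ[ℝ]
      CSF (overlap c d) (Fin q),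
    IsCotangentLift (transition c d) Ψ ∧
    PSF.map Ψ (PSF.map (SF.res (cot_mono (overlap_le_right c d))) (F d)) =
      PSF.map (SF.res (cot_mono (overlap_le_left c d))) (F c)

/-- The family is a vector field on `M`: on overlaps, the component `X^A` in the chart `c` is
obtained by applying the vector field, written in the chart `d`, to the coordinate `x^A` of `c`. -/
def IsVectorField (X : VecFamily B M) : Prop :=
  ∀ (c d : M.Charts) (A : Fin p ⊕ Fin q),
    PSF.map (transition c d).toAlgHom
        (act (fun C => PSF.map (SF.res (overlap_le_right c d)) (X d C))
          (PSF.const ((transition c d).symm (SF.coord A)))) =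
      PSF.map (SF.res (overlap_le_left c d)) (X c A)

/-- A family of functions is homogeneous of parity `n` mod 2. -/
def CotHasParity (n : ℕ) (F : CotFamily B M) : Prop := ∀ c, PSF.HasParity n (F c)

/-- A vector field is homogeneous of parity `n` mod 2. -/
def VecHasParity (n : ℕ) (X : VecFamily B M) : Prop :=
  ∀ c A, PSF.HasParity (n + deg A) (X c A)

/-- The canonical Poisson bracket on the cotangent bundle. -/
def pb (F G : CotFamily B M) : CotFamily B M := fun c => poisson (F c) (G c)

/-- The symbol of a vector field, a function on the cotangent bundle. -/
def symbol (X : VecFamily B M) : CotFamily B M := fun c => symb (X c)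

/-- An odd vector field `Q` with `Q² = 0`. -/
structure IsHomological (Q : VecFamily B M) : Prop where
  isVectorField : IsVectorField Q
  odd : VecHasParity 1 Q
  sq_zero : ∀ (c : M.Charts) (f : PSF B (ran c) (Fin q)), act (Q c) (act (Q c) f) = 0

/-- An odd function on the cotangent bundle, of degree two in the fibre coordinates. -/
structure IsAlmostSchouten (S : CotFamily B M) : Prop where
  isCotFunction : IsCotFunction S
  odd : CotHasParity 1 S
  degreeTwo : ∀ c, DegreeTwo (S c)

/-- A Schouten structure. -/
structure IsSchouten (S : CotFamily B M) : Prop extends IsAlmostSchouten S where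
  schouten : pb S S = 0

/-- A QS structure `(S, Q)`. The Lie derivative along a vector field of functions on the cotangent
bundle is the Poisson bracket with the symbol. -/
structure IsQS (S : CotFamily B M) (Q : VecFamily B M) : Prop where
  isSchouten : IsSchouten S
  isHomological : IsHomological Q
  invariant : pb (symbol Q) S = 0

/-- An odd Jacobi structure `(S, Q)`. -/
structure IsOddJacobi (S : CotFamily B M) (Q : VecFamily B M) : Prop where
  isAlmostSchouten : IsAlmostSchouten S
  isHomological : IsHomological Q
  invariant : pb (symbol Q) S = 0
  compatible : pb S S = (-2 : B) • (symbol Q * S)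

/-- An exact QS structure `(S, Q)` with homothety vector field `E`: an even vector field with
`L_E S = -S` and `L_E Q = [E, Q] = -Q`. -/
structure IsExactQS (S : CotFamily B M) (Q E : VecFamily B M) : Prop extends IsQS S Q where
  isVectorField : IsVectorField E
  even : VecHasParity 0 E
  lie_S : pb (symbol E) S = -S
  lie_Q : ∀ (c : M.Charts) (f : PSF B (ran c) (Fin q)),
    act (E c) (act (Q c) f) - act (Q c) (act (E c) f) = -act (Q c) f

variable (B)

/-- A function on the cotangent bundle, regarded as one with parameters from `B`. -/
def CotFamily.extend (F : CotFamily ℝ M) : CotFamily B M :=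
  fun c => PSF.extend B (F c)

/-- A vector field, regarded as one with parameters from `B`. -/
def VecFamily.extend (X : VecFamily ℝ M) : VecFamily B M :=
  fun c A => PSF.extend B (X c A)

end Global

end OddJacobi

end

/-!
Everything is a computation in a single chart, except that the pair is compatible with changes of
charts.

Write `s` for the local expression of `S`, and `e`, `t` for the symbols of `E` and `Q`; here `e` is
even, `s` and `t` are odd. Functions on the cotangent bundle supercommute
(`PSF.HasParity.mul_comm`), so `t² = 0`. The canonical bracket is graded antisymmetric
(`poisson_comm`) and satisfies the graded Leibniz rule (`poisson_mul_right`), and on symbols it is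
the symbol of the graded commutator (`poisson_symb_symb`). Applying the identities `Q² = 0` and
`[E, Q] = -Q` to the coordinate functions gives `{t, t} = 0` and `{e, t} = -t`. Together with
`{s, s} = 0`, `{t, s} = 0` and `{e, s} = -s` this yields `{t, e t} = t² = 0`, `{s, e t} = s t` and
`{e t, e t} = 0`, hence
`{a s + b e t, a s + b e t} = 2 a b s t = -2 (b t) (a s + b e t)` (`poisson_self_add_mul`).
The Jacobi identity of the bracket is not needed.

For the change of charts, the cotangent lift witnessing that `S` is a function on the cotangent
bundle also transforms symbols of vector fields correctly (`IsCotangentLift.map_symb`); being an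
algebra homomorphism, it transforms `a S + b e t` correctly.

The argument works over any algebra `B` of even parameters, and extension of parameters from `ℝ` to
`B` preserves exact QS structures (`IsExactQS.extend`), since all operations are `B`-linear
extensions of the real ones.
-/

noncomputable section

set_option linter.unusedSectionVars false

namespace OddJacobi

/-! ### The Grassmann algebra -/

section GrassmannAlgebra

open CliffordAlgebra

variable {κ κ' : Type}

theorem Grassmann.mul_ι (θ : Grassmann κ) (v : κ → ℝ) :
    θ * ExteriorAlgebra.ι ℝ v = ExteriorAlgebra.ι ℝ v * involute θ := by
  induction θ using ExteriorAlgebra.induction with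
  | algebraMap r => simp [Algebra.commutes]
  | ι w =>
    rw [show involute (ExteriorAlgebra.ι ℝ w) = -ExteriorAlgebra.ι ℝ w from involute_ι w, mul_neg]
    exact eq_neg_of_add_eq_zero_left (ExteriorAlgebra.ι_add_mul_swap w v)
  | mul a b ha hb => rw [mul_assoc, hb, ← mul_assoc, ha, map_mul, mul_assoc]
  | add a b ha hb => rw [add_mul, ha, hb, map_add, mul_add]

/-- The even part of a Grassmann element (times two) is central. -/
theorem Grassmann.add_involute_mul (θ η : Grassmann κ) :
    (θ + involute θ) * η = η * (θ + involute θ) := by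
  induction η using ExteriorAlgebra.induction with
  | algebraMap r => exact (Algebra.commutes r _).symm
  | ι v =>
    rw [add_mul, Grassmann.mul_ι, Grassmann.mul_ι, involute_involute, mul_add, add_comm]
  | mul a b ha hb => rw [← mul_assoc, ha, mul_assoc, hb, mul_assoc]
  | add a b ha hb => rw [mul_add, ha, hb, add_mul]

/-- The odd part of a Grassmann element (times two) commutes with others up to parity. -/
theorem Grassmann.sub_involute_mul (θ η : Grassmann κ) :
    (θ - involute θ) * η = involute η * (θ - involute θ) := by
  induction η using ExteriorAlgebra.induction with
  | algebraMap r => rw [AlgHom.commutes]; exact (Algebra.commutes r _).symm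
  | ι v =>
    rw [sub_mul, Grassmann.mul_ι, Grassmann.mul_ι, involute_involute, mul_sub,
      show involute (ExteriorAlgebra.ι ℝ v) = -ExteriorAlgebra.ι ℝ v from involute_ι v]
    noncomm_ring
  | mul a b ha hb => rw [← mul_assoc, ha, mul_assoc, hb, map_mul, mul_assoc]
  | add a b ha hb => rw [mul_add, ha, hb, map_add, add_mul]

theorem Grassmann.contractLeft_mul (d : Module.Dual ℝ (κ → ℝ)) (θ η : Grassmann κ) :
    contractLeft d (θ * η) = contractLeft d θ * η + involute θ * contractLeft d η := by
  induction θ using ExteriorAlgebra.induction generalizing η with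
  | algebraMap r =>
    rw [AlgHom.commutes, contractLeft_algebraMap, zero_mul, zero_add]
    exact contractLeft_algebraMap_mul d r η
  | ι v =>
    rw [show involute (ExteriorAlgebra.ι ℝ v) = -ExteriorAlgebra.ι ℝ v from involute_ι v,
      show contractLeft d (ExteriorAlgebra.ι ℝ v) = algebraMap ℝ _ (d v) from contractLeft_ι _ d v,
      show contractLeft d (ExteriorAlgebra.ι ℝ v * η) = _ from contractLeft_ι_mul d v η,
      Algebra.smul_def, neg_mul, sub_eq_add_neg]
  | mul a b ha hb => rw [mul_assoc, ha, hb, ha, map_mul]; noncomm_ring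
  | add a b ha hb => rw [add_mul, map_add, ha, hb, map_add, map_add]; noncomm_ring

theorem Grassmann.involute_contractLeft (d : Module.Dual ℝ (κ → ℝ)) (θ : Grassmann κ) :
    involute (contractLeft d θ) = -contractLeft d (involute θ) := by
  induction θ using ExteriorAlgebra.induction with
  | algebraMap r =>
    rw [AlgHom.commutes, contractLeft_algebraMap, map_zero, neg_zero]
  | ι v =>
    rw [show involute (ExteriorAlgebra.ι ℝ v) = -ExteriorAlgebra.ι ℝ v from involute_ι v,
      map_neg, show contractLeft d (ExteriorAlgebra.ι ℝ v) = algebraMap ℝ _ (d v) from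
        contractLeft_ι _ d v, AlgHom.commutes, neg_neg]
  | mul a b ha hb =>
    rw [Grassmann.contractLeft_mul, map_add, map_mul, map_mul, map_mul,
      Grassmann.contractLeft_mul, ha, hb]
    noncomm_ring
  | add a b ha hb => rw [map_add, map_add, ha, hb, map_add, map_add, neg_add]

theorem Grassmann.involute_map (g : (κ → ℝ) →ₗ[ℝ] (κ' → ℝ)) (θ : Grassmann κ) :
    involute (ExteriorAlgebra.map g θ) = ExteriorAlgebra.map g (involute θ) := by
  induction θ using ExteriorAlgebra.induction with
  | algebraMap r => simp only [AlgHom.commutes]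
  | ι v =>
    rw [show involute (ExteriorAlgebra.ι ℝ v) = -ExteriorAlgebra.ι ℝ v from involute_ι v,
      map_neg, ExteriorAlgebra.map_apply_ι]
    exact involute_ι _
  | mul a b ha hb => simp only [map_mul, ha, hb]
  | add a b ha hb => simp only [map_add, ha, hb]

theorem Grassmann.contractLeft_map (d : Module.Dual ℝ (κ' → ℝ)) (g : (κ → ℝ) →ₗ[ℝ] (κ' → ℝ))
    (θ : Grassmann κ) :
    contractLeft d (ExteriorAlgebra.map g θ) =
      ExteriorAlgebra.map g (contractLeft (d ∘ₗ g) θ) := by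
  induction θ using ExteriorAlgebra.induction with
  | algebraMap r => simp only [AlgHom.commutes, contractLeft_algebraMap, map_zero]
  | ι v =>
    rw [ExteriorAlgebra.map_apply_ι,
      show contractLeft d (ExteriorAlgebra.ι ℝ (g v)) = algebraMap ℝ _ (d (g v)) from
        contractLeft_ι _ d _,
      show contractLeft (d ∘ₗ g) (ExteriorAlgebra.ι ℝ v) = algebraMap ℝ _ (d (g v)) from
        contractLeft_ι _ _ v, AlgHom.commutes]
  | mul a b ha hb =>
    simp only [map_mul, map_add, Grassmann.contractLeft_mul, ha, hb, Grassmann.involute_map]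
  | add a b ha hb => simp only [map_add, ha, hb]

end GrassmannAlgebra

/-! ### Smooth functions -/

section SmoothFunctions

variable {ι : Type}

theorem extendZero_eventuallyEq {U : Opens (ι → ℝ)} (f : U → ℝ) {g : (ι → ℝ) → ℝ}
    (h : ∀ x (hx : x ∈ U), f ⟨x, hx⟩ = g x) {x : ι → ℝ} (hx : x ∈ U) :
    extendZero f =ᶠ[nhds x] g := by
  filter_upwards [U.isOpen.mem_nhds hx] with y hy
  rw [extendZero_apply f (show y ∈ U from hy), h y hy]

variable [Fintype ι]

theorem Smooth.ext {U : Opens (ι → ℝ)} {f g : Smooth U} (h : ∀ x, f.1 x = g.1 x) : f = g :=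
  Subtype.ext (funext h)

/-- The `a`-th coordinate as a smooth function. -/
def Smooth.coord {U : Opens (ι → ℝ)} (a : ι) : Smooth U :=
  ⟨fun x => x.1 a, (contDiff_apply ℝ ℝ a).contDiffOn.congr fun _ hx => extendZero_apply _ hx⟩

/-- Pull-back along the projection of the cotangent bundle of an open set of `ℝ^ι`. -/
abbrev Smooth.lift (U : Opens (ι → ℝ)) : Smooth U →ₐ[ℝ] Smooth (cot U) :=
  Smooth.pullback (fun z a => z (.inl a)) (by fun_prop) fun _ hz => hz

theorem Smooth.fderiv_lift {U : Opens (ι → ℝ)} (f : Smooth U) (z : cot U) (v : ι ⊕ ι → ℝ) :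
    fderiv ℝ (extendZero (Smooth.lift U f).1) z.1 v =
      fderiv ℝ (extendZero f.1) (fun a => z.1 (.inl a)) fun a => v (.inl a) := by
  let π : (ι ⊕ ι → ℝ) →L[ℝ] (ι → ℝ) := ContinuousLinearMap.pi fun a =>
    ContinuousLinearMap.proj (.inl a)
  have hf : DifferentiableAt ℝ (extendZero f.1) (π z.1) :=
    (smooth_contDiffAt f (show π z.1 ∈ U from z.2)).differentiableAt (by simp)
  have h : extendZero (Smooth.lift U f).1 =ᶠ[nhds z.1] extendZero f.1 ∘ π :=
    extendZero_eventuallyEq (Smooth.lift U f).1 (fun y hy => (extendZero_apply f.1 hy).symm) z.2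
  rw [h.fderiv_eq, fderiv_comp _ hf π.differentiableAt, π.fderiv]
  rfl

variable [DecidableEq ι]

theorem Smooth.partialDeriv_mul {U : Opens (ι → ℝ)} (a : ι) (f g : Smooth U) :
    Smooth.partialDeriv a (f * g) = Smooth.partialDeriv a f * g + f * Smooth.partialDeriv a g := by
  refine Smooth.ext fun x => ?_
  have hf := (smooth_contDiffAt f x.2).differentiableAt (by simp)
  have hg := (smooth_contDiffAt g x.2).differentiableAt (by simp)
  have h : extendZero (f * g).1 =ᶠ[nhds x.1] extendZero f.1 * extendZero g.1 :=
    extendZero_eventuallyEq _ (fun y hy => by simp [extendZero_apply _ hy]) x.2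
  change fderiv ℝ (extendZero (f * g).1) x.1 _ = fderiv ℝ (extendZero f.1) x.1 _ * g.1 x
    + f.1 x * fderiv ℝ (extendZero g.1) x.1 _
  rw [h.fderiv_eq, fderiv_mul hf hg, extendZero_apply f.1 x.2, extendZero_apply g.1 x.2]
  simp [mul_comm, add_comm]

theorem Smooth.partialDeriv_coord {U : Opens (ι → ℝ)} (a b : ι) :
    Smooth.partialDeriv a (Smooth.coord b : Smooth U) = if b = a then 1 else 0 := by
  refine Smooth.ext fun x => ?_
  have h : extendZero (Smooth.coord b : Smooth U).1 =ᶠ[nhds x.1] fun y => y b :=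
    extendZero_eventuallyEq _ (fun _ _ => rfl) x.2
  change fderiv ℝ (extendZero (Smooth.coord b : Smooth U).1) x.1 (Pi.single a 1) = _
  rw [h.fderiv_eq, (hasFDerivAt_apply b x.1).fderiv]
  by_cases hba : b = a
  · subst hba; simp
  · simp [hba]

theorem Smooth.partialDeriv_inl_lift {U : Opens (ι → ℝ)} (a : ι) (f : Smooth U) :
    Smooth.partialDeriv (.inl a) (Smooth.lift U f) = Smooth.lift U (Smooth.partialDeriv a f) := by
  refine Smooth.ext fun z => (Smooth.fderiv_lift f z _).trans ?_
  refine congrArg (fderiv ℝ (extendZero f.1) _) (funext fun b => ?_)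
  simp [Pi.single_apply]

theorem Smooth.partialDeriv_inr_lift {U : Opens (ι → ℝ)} (a : ι) (f : Smooth U) :
    Smooth.partialDeriv (.inr a) (Smooth.lift U f) = 0 := by
  refine Smooth.ext fun z => (Smooth.fderiv_lift f z _).trans ?_
  rw [show (fun b => (Pi.single (.inr a) 1 : ι ⊕ ι → ℝ) (.inl b)) = 0 from
    funext fun b => by simp, map_zero]
  rfl

end SmoothFunctions

/-! ### Superfunctions -/

section Superfunctions

variable {ι κ : Type} [Fintype ι] {U V : Opens (ι → ℝ)}

/-- The superfunction `f θ` with a smooth function `f` and a Grassmann element `θ`. -/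
def SF.mk (f : Smooth U) (θ : Grassmann κ) : SF U κ := (f ⊗ₜ θ : Smooth U ⊗[ℝ] Grassmann κ)

@[elab_as_elim]
theorem SF.induction {motive : SF U κ → Prop} (F : SF U κ)
    (mk : ∀ f θ, motive (SF.mk f θ)) (add : ∀ F G, motive F → motive G → motive (F + G)) :
    motive F :=
  TensorProduct.induction_on (motive := motive) F
    (by simpa [SF.mk] using mk 0 0) mk add

theorem SF.mk_mul_mk (f g : Smooth U) (θ η : Grassmann κ) :
    SF.mk f θ * SF.mk g η = SF.mk (f * g) (θ * η) :=
  Algebra.TensorProduct.tmul_mul_tmul f g θ η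

theorem SF.mk_add (f : Smooth U) (θ η : Grassmann κ) :
    SF.mk f (θ + η) = SF.mk f θ + SF.mk f η :=
  TensorProduct.tmul_add _ _ _

theorem SF.add_mk (f g : Smooth U) (θ : Grassmann κ) :
    SF.mk (f + g) θ = SF.mk f θ + SF.mk g θ :=
  TensorProduct.add_tmul _ _ _

theorem SF.mk_sub (f : Smooth U) (θ η : Grassmann κ) :
    SF.mk f (θ - η) = SF.mk f θ - SF.mk f η :=
  TensorProduct.tmul_sub _ _ _

theorem SF.mk_neg (f : Smooth U) (θ : Grassmann κ) : SF.mk f (-θ) = -SF.mk f θ :=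
  TensorProduct.tmul_neg _ _

theorem SF.mk_zero (f : Smooth U) : SF.mk f (0 : Grassmann κ) = 0 :=
  TensorProduct.tmul_zero _ _

theorem SF.zero_mk (θ : Grassmann κ) : SF.mk (0 : Smooth U) θ = 0 :=
  TensorProduct.zero_tmul _ _

theorem SF.mk_one_one : SF.mk (1 : Smooth U) (1 : Grassmann κ) = 1 := rfl

variable [DecidableEq ι] [DecidableEq κ]

theorem SF.coord_inl (a : ι) :
    (SF.coord (.inl a) : SF U κ) = SF.mk (Smooth.coord a) 1 := rfl

theorem SF.coord_inr (j : κ) :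
    (SF.coord (.inr j) : SF U κ) = SF.mk 1 (ExteriorAlgebra.ι ℝ (Pi.single j 1)) := rfl

theorem SF.inv_mk (f : Smooth U) (θ : Grassmann κ) :
    SF.inv (SF.mk f θ) = SF.mk f (CliffordAlgebra.involute θ) := rfl

theorem SF.partialDeriv_inl_mk (a : ι) (f : Smooth U) (θ : Grassmann κ) :
    SF.partialDeriv (.inl a) (SF.mk f θ) = SF.mk (Smooth.partialDeriv a f) θ := rfl

theorem SF.partialDeriv_inr_mk (j : κ) (f : Smooth U) (θ : Grassmann κ) :
    SF.partialDeriv (.inr j) (SF.mk f θ) =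
      SF.mk f (CliffordAlgebra.contractLeft (LinearMap.proj j) θ) := rfl

/-- The inclusion of the odd generators of a superdomain into those of its cotangent bundle. -/
def oddPos (κ : Type) : (κ → ℝ) →ₗ[ℝ] (κ ⊕ κ → ℝ) where
  toFun v := Sum.elim v 0
  map_add' v w := by ext (j | j) <;> simp
  map_smul' r v := by ext (j | j) <;> simp

theorem SF.lift_mk (f : Smooth U) (θ : Grassmann κ) :
    SF.lift (SF.mk f θ) = SF.mk (Smooth.lift U f) (ExteriorAlgebra.map (oddPos κ) θ) := rfl

/-- `(-1)^{|A||F|} F` for the coordinate index `A`, extended linearly to all `F`. -/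
def SF.twist {α β : Type} (A : α ⊕ β) (F : SF U κ) : SF U κ :=
  Sum.elim (fun _ => F) (fun _ => SF.inv F) A

/-- The partial derivatives are left superderivations. -/
theorem SF.partialDeriv_mul (A : ι ⊕ κ) (F G : SF U κ) :
    SF.partialDeriv A (F * G) =
      SF.partialDeriv A F * G + SF.twist A F * SF.partialDeriv A G := by
  induction F using SF.induction with
  | add F F' hF hF' =>
    have : SF.twist A (F + F') = SF.twist A F + SF.twist A F' := by
      rcases A with a | j <;> simp [SF.twist]
    rw [add_mul, map_add, hF, hF', map_add, this]
    noncomm_ring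
  | mk f θ =>
  induction G using SF.induction with
  | add G G' hG hG' => rw [mul_add, map_add, hG, hG', map_add]; noncomm_ring
  | mk g η =>
  rcases A with a | j
  · simp only [SF.twist, Sum.elim_inl, SF.mk_mul_mk, SF.partialDeriv_inl_mk,
      Smooth.partialDeriv_mul, SF.add_mk]
  · simp only [SF.twist, Sum.elim_inr, SF.mk_mul_mk, SF.partialDeriv_inr_mk, SF.inv_mk,
      Grassmann.contractLeft_mul, SF.mk_add]

theorem SF.inv_partialDeriv (A : ι ⊕ κ) (F : SF U κ) :
    SF.inv (SF.partialDeriv A F) = (-1 : ℝ) ^ deg A • SF.partialDeriv A (SF.inv F) := by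
  induction F using SF.induction with
  | add F F' hF hF' => simp only [map_add, hF, hF', smul_add]
  | mk f θ =>
  rcases A with a | j
  · simp [deg, SF.partialDeriv_inl_mk, SF.inv_mk]
  · simp [deg, SF.partialDeriv_inr_mk, SF.inv_mk, Grassmann.involute_contractLeft, SF.mk_neg]

theorem SF.add_inv_mul (F G : SF U κ) : (F + SF.inv F) * G = G * (F + SF.inv F) := by
  induction F using SF.induction with
  | add F F' hF hF' =>
    rw [map_add, add_add_add_comm, add_mul, hF, hF', ← mul_add]
  | mk f θ =>
  induction G using SF.induction with
  | add G G' hG hG' => rw [mul_add, hG, hG', add_mul]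
  | mk g η =>
  rw [SF.inv_mk, ← SF.mk_add, SF.mk_mul_mk, SF.mk_mul_mk, Grassmann.add_involute_mul, mul_comm f]

theorem SF.sub_inv_mul (F G : SF U κ) : (F - SF.inv F) * G = SF.inv G * (F - SF.inv F) := by
  induction F using SF.induction with
  | add F F' hF hF' =>
    rw [map_add, add_sub_add_comm, add_mul, hF, hF', mul_add]
  | mk f θ =>
  induction G using SF.induction with
  | add G G' hG hG' => rw [mul_add, hG, hG', map_add, add_mul]
  | mk g η =>
  rw [SF.inv_mk, ← SF.mk_sub, SF.mk_mul_mk, SF.inv_mk, SF.mk_mul_mk, Grassmann.sub_involute_mul,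
    mul_comm f]

theorem SF.inv_coord (A : ι ⊕ κ) :
    SF.inv (SF.coord A : SF U κ) = (-1 : ℝ) ^ deg A • SF.coord A := by
  rcases A with a | j
  · simp [deg, SF.coord_inl, SF.inv_mk]
  · rw [SF.coord_inr, SF.inv_mk, show CliffordAlgebra.involute (ExteriorAlgebra.ι ℝ
      (Pi.single j 1 : κ → ℝ)) = _ from CliffordAlgebra.involute_ι _, SF.mk_neg]
    simp only [deg, Sum.elim_inr, pow_one, neg_smul, one_smul]

theorem SF.partialDeriv_coord (A C : ι ⊕ κ) :
    SF.partialDeriv A (SF.coord C : SF U κ) = if C = A then 1 else 0 := by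
  rcases A with a | j <;> rcases C with b | k
  · rw [SF.coord_inl, SF.partialDeriv_inl_mk, Smooth.partialDeriv_coord]
    by_cases h : b = a
    · rw [if_pos h, if_pos (congrArg _ h), SF.mk_one_one]
    · rw [if_neg h, if_neg fun h' => h (Sum.inl_injective h'), SF.zero_mk]
  · have h : Smooth.partialDeriv a (1 : Smooth U) = 0 := by
      have := Smooth.partialDeriv_mul a (1 : Smooth U) 1
      rw [mul_one, mul_one, one_mul] at this
      exact left_eq_add.1 this
    rw [SF.coord_inr, SF.partialDeriv_inl_mk, h, SF.zero_mk, if_neg Sum.inr_ne_inl]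
  · rw [SF.coord_inl, SF.partialDeriv_inr_mk, CliffordAlgebra.contractLeft_one, SF.mk_zero,
      if_neg Sum.inl_ne_inr]
  · rw [SF.coord_inr, SF.partialDeriv_inr_mk, show CliffordAlgebra.contractLeft (LinearMap.proj j)
      (ExteriorAlgebra.ι ℝ (Pi.single k 1 : κ → ℝ)) = _ from CliffordAlgebra.contractLeft_ι _ _ _]
    by_cases h : k = j
    · subst h; simp [SF.mk_one_one]
    · simp [h, SF.mk_zero, Ne.symm h]

/-! ### Pull-back to the cotangent bundle -/

theorem SF.inv_lift (F : SF U κ) : SF.inv (SF.lift F) = SF.lift (SF.inv F) := by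
  induction F using SF.induction with
  | add F F' hF hF' => simp only [map_add, hF, hF']
  | mk f θ => rw [SF.lift_mk, SF.inv_mk, SF.inv_mk, SF.lift_mk, Grassmann.involute_map]

theorem SF.partialDeriv_posIdx_lift (A : ι ⊕ κ) (F : SF U κ) :
    SF.partialDeriv (posIdx A) (SF.lift F) = SF.lift (SF.partialDeriv A F) := by
  induction F using SF.induction with
  | add F F' hF hF' => simp only [map_add, hF, hF']
  | mk f θ =>
  rcases A with a | j
  · rw [posIdx, Sum.map_inl, SF.lift_mk, SF.partialDeriv_inl_mk, SF.partialDeriv_inl_mk,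
      SF.lift_mk, Smooth.partialDeriv_inl_lift]
  · rw [posIdx, Sum.map_inr, SF.lift_mk, SF.partialDeriv_inr_mk, SF.partialDeriv_inr_mk,
      SF.lift_mk, Grassmann.contractLeft_map]
    rfl

theorem SF.partialDeriv_momIdx_lift (A : ι ⊕ κ) (F : SF U κ) :
    SF.partialDeriv (momIdx A) (SF.lift F) = 0 := by
  induction F using SF.induction with
  | add F F' hF hF' => simp only [map_add, hF, hF', add_zero]
  | mk f θ =>
  rcases A with a | j
  · rw [momIdx, Sum.map_inl, SF.lift_mk, SF.partialDeriv_inl_mk, Smooth.partialDeriv_inr_lift,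
      SF.zero_mk]
  · have h : (LinearMap.proj (.inr j) : (κ ⊕ κ → ℝ) →ₗ[ℝ] ℝ) ∘ₗ oddPos κ = 0 := rfl
    rw [momIdx, Sum.map_inr, SF.lift_mk, SF.partialDeriv_inr_mk, Grassmann.contractLeft_map, h]
    simp [SF.mk_zero]

theorem SF.res_lift (h : V ≤ U) (F : SF U κ) :
    SF.res (cot_mono h) (SF.lift F) = SF.lift (SF.res h F) := by
  induction F using SF.induction with
  | add F F' hF hF' => simp only [map_add, hF, hF']
  | mk f θ => rfl

theorem SF.res_coord (h : V ≤ U) (A : ι ⊕ κ) :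
    SF.res h (SF.coord A : SF U κ) = SF.coord A := by
  rcases A with a | j <;> rfl

end Superfunctions

/-! ### Superfunctions with even parameters -/

section Parameters

variable {ι κ ι' κ' : Type} [Fintype ι] [Fintype ι'] [DecidableEq ι] [Fintype κ] [DecidableEq κ]
  {B : Type v} [CommRing B] [Algebra ℝ B] {U : Opens (ι → ℝ)} {U' : Opens (ι' → ℝ)}

/-- The superfunction `b F` with a parameter `b` and a superfunction `F` without parameters. -/
def PSF.mk (b : B) (F : SF U κ) : PSF B U κ := (b ⊗ₜ F : B ⊗[ℝ] SF U κ)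

@[elab_as_elim]
theorem PSF.induction {motive : PSF B U κ → Prop} (F : PSF B U κ)
    (mk : ∀ b f, motive (PSF.mk b f)) (add : ∀ F G, motive F → motive G → motive (F + G)) :
    motive F :=
  TensorProduct.induction_on (motive := motive) F
    (by simpa [PSF.mk] using mk 0 0) mk add

theorem PSF.mk_mul_mk (b c : B) (F G : SF U κ) :
    PSF.mk b F * PSF.mk c G = PSF.mk (b * c) (F * G) :=
  Algebra.TensorProduct.tmul_mul_tmul b c F G

theorem PSF.mk_add (b : B) (F G : SF U κ) : PSF.mk b (F + G) = PSF.mk b F + PSF.mk b G :=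
  TensorProduct.tmul_add _ _ _

theorem PSF.mk_sub (b : B) (F G : SF U κ) : PSF.mk b (F - G) = PSF.mk b F - PSF.mk b G :=
  TensorProduct.tmul_sub _ _ _

theorem PSF.mk_neg (b : B) (F : SF U κ) : PSF.mk b (-F) = -PSF.mk b F :=
  TensorProduct.tmul_neg _ _

theorem PSF.mk_zero (b : B) : PSF.mk b (0 : SF U κ) = 0 :=
  TensorProduct.tmul_zero _ _

theorem PSF.smul_mk (b c : B) (F : SF U κ) : b • PSF.mk c F = PSF.mk (b * c) F := rfl

theorem PSF.const_eq (F : SF U κ) : (PSF.const F : PSF B U κ) = PSF.mk 1 F := rfl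

theorem PSF.map_mk (φ : SF U κ →ₐ[ℝ] SF U' κ') (b : B) (F : SF U κ) :
    PSF.map φ (PSF.mk b F) = PSF.mk b (φ F) := rfl

theorem PSF.partialDeriv_mk (A : ι ⊕ κ) (b : B) (F : SF U κ) :
    PSF.partialDeriv A (PSF.mk b F) = PSF.mk b (SF.partialDeriv A F) := rfl

theorem PSF.map_const (φ : SF U κ →ₐ[ℝ] SF U' κ') (F : SF U κ) :
    PSF.map φ (PSF.const F : PSF B U κ) = PSF.const (φ F) := rfl

theorem PSF.partialDeriv_const (A : ι ⊕ κ) (F : SF U κ) :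
    PSF.partialDeriv A (PSF.const F : PSF B U κ) = PSF.const (SF.partialDeriv A F) := rfl

theorem PSF.twist_mk (A : ι ⊕ κ) (b : B) (F : SF U κ) :
    PSF.twist A (PSF.mk b F) = PSF.mk b (SF.twist A F) := by
  rcases A with a | j <;> rfl

theorem PSF.twist_add {α β : Type} (A : α ⊕ β) (F G : PSF B U κ) :
    PSF.twist A (F + G) = PSF.twist A F + PSF.twist A G := by
  rcases A with a | j
  · rfl
  · exact map_add _ _ _

theorem PSF.twist_smul {α β : Type} (A : α ⊕ β) (b : B) (F : PSF B U κ) :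
    PSF.twist A (b • F) = b • PSF.twist A F := by
  rcases A with a | j
  · rfl
  · exact map_smul _ _ _

theorem PSF.partialDeriv_mul (A : ι ⊕ κ) (F G : PSF B U κ) :
    PSF.partialDeriv A (F * G) =
      PSF.partialDeriv A F * G + PSF.twist A F * PSF.partialDeriv A G := by
  induction F using PSF.induction with
  | add F F' hF hF' => rw [add_mul, map_add, hF, hF', map_add, PSF.twist_add]; noncomm_ring
  | mk b f =>
  induction G using PSF.induction with
  | add G G' hG hG' => rw [mul_add, map_add, hG, hG', map_add]; noncomm_ring
  | mk c g =>
  simp only [PSF.mk_mul_mk, PSF.partialDeriv_mk, PSF.twist_mk, SF.partialDeriv_mul, PSF.mk_add]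

theorem PSF.inv_partialDeriv (A : ι ⊕ κ) (F : PSF B U κ) :
    PSF.map SF.inv (PSF.partialDeriv A F) =
      (-1 : B) ^ deg A • PSF.partialDeriv A (PSF.map SF.inv F) := by
  induction F using PSF.induction with
  | add F F' hF hF' => simp only [map_add, hF, hF', smul_add]
  | mk b f =>
  rw [PSF.partialDeriv_mk, PSF.map_mk, PSF.map_mk, PSF.partialDeriv_mk, SF.inv_partialDeriv]
  rcases A with a | j
  · simp [deg]
  · simp [deg, PSF.mk_neg]

theorem PSF.add_inv_mul (F G : PSF B U κ) :
    (F + PSF.map SF.inv F) * G = G * (F + PSF.map SF.inv F) := by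
  induction F using PSF.induction with
  | add F F' hF hF' => rw [map_add, add_add_add_comm, add_mul, hF, hF', ← mul_add]
  | mk b f =>
  induction G using PSF.induction with
  | add G G' hG hG' => rw [mul_add, hG, hG', add_mul]
  | mk c g =>
  rw [PSF.map_mk, ← PSF.mk_add, PSF.mk_mul_mk, PSF.mk_mul_mk, SF.add_inv_mul, mul_comm b]

theorem PSF.sub_inv_mul (F G : PSF B U κ) :
    (F - PSF.map SF.inv F) * G = PSF.map SF.inv G * (F - PSF.map SF.inv F) := by
  induction F using PSF.induction with
  | add F F' hF hF' => rw [map_add, add_sub_add_comm, add_mul, hF, hF', ← mul_add]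
  | mk b f =>
  induction G using PSF.induction with
  | add G G' hG hG' => rw [mul_add, hG, hG', map_add, add_mul]
  | mk c g =>
  rw [PSF.map_mk, ← PSF.mk_sub, PSF.mk_mul_mk, PSF.map_mk, PSF.mk_mul_mk, SF.sub_inv_mul,
    mul_comm b]

theorem PSF.map_map {ι'' κ'' : Type} [Fintype ι''] {U'' : Opens (ι'' → ℝ)}
    (φ : SF U κ →ₐ[ℝ] SF U' κ') (χ : SF U' κ' →ₐ[ℝ] SF U'' κ'') (F : PSF B U κ) :
    PSF.map χ (PSF.map φ F) = PSF.map (χ.comp φ) F := by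
  induction F using PSF.induction with
  | add F F' hF hF' => simp only [map_add, hF, hF']
  | mk b f => rfl

/-! ### Parity -/

theorem PSF.HasParity.add {n : ℕ} {F G : PSF B U κ} (hF : PSF.HasParity n F)
    (hG : PSF.HasParity n G) : PSF.HasParity n (F + G) := by
  simp only [PSF.HasParity] at *
  rw [map_add, hF, hG, smul_add]

theorem PSF.HasParity.smul {n : ℕ} {F : PSF B U κ} (hF : PSF.HasParity n F) (b : B) :
    PSF.HasParity n (b • F) := by
  simp only [PSF.HasParity] at *
  rw [map_smul, hF, smul_comm]

theorem PSF.HasParity.sum {α : Type} {n : ℕ} {s : Finset α} {F : α → PSF B U κ}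
    (hF : ∀ i ∈ s, PSF.HasParity n (F i)) : PSF.HasParity n (∑ i ∈ s, F i) := by
  simp only [PSF.HasParity] at *
  rw [map_sum, Finset.smul_sum]
  exact Finset.sum_congr rfl hF

theorem PSF.HasParity.mul {m n : ℕ} {F G : PSF B U κ} (hF : PSF.HasParity m F)
    (hG : PSF.HasParity n G) : PSF.HasParity (m + n) (F * G) := by
  simp only [PSF.HasParity] at *
  rw [map_mul, hF, hG, smul_mul_smul_comm, pow_add]

theorem PSF.HasParity.congr {m n : ℕ} {F : PSF B U κ} (hF : PSF.HasParity m F)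
    (h : Even m ↔ Even n) : PSF.HasParity n F :=
  hF.trans (by rw [neg_one_pow_congr h])

theorem PSF.HasParity.partialDeriv {n : ℕ} {F : PSF B U κ} (hF : PSF.HasParity n F)
    (A : ι ⊕ κ) : PSF.HasParity (n + deg A) (PSF.partialDeriv A F) := by
  simp only [PSF.HasParity] at *
  rw [PSF.inv_partialDeriv, hF, map_smul, smul_smul, pow_add, mul_comm]

theorem PSF.HasParity.twist {α β : Type} {n : ℕ} {F : PSF B U κ} (hF : PSF.HasParity n F)
    (A : α ⊕ β) : PSF.twist A F = (-1 : B) ^ (deg A * n) • F := by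
  rcases A with a | j
  · simp [PSF.twist, deg]
  · simpa [PSF.HasParity, PSF.twist, deg] using hF

theorem isUnit_two : IsUnit (2 : B) := by
  rw [← map_ofNat (algebraMap ℝ B) 2]
  exact (IsUnit.mk0 (2 : ℝ) two_ne_zero).map (algebraMap ℝ B)

/-- Superfunctions supercommute. -/
theorem PSF.HasParity.mul_comm {m n : ℕ} {F G : PSF B U κ} (hF : PSF.HasParity m F)
    (hG : PSF.HasParity n G) : F * G = (-1 : B) ^ (m * n) • (G * F) := by
  refine (isUnit_two (B := B)).smul_left_cancel.1 ?_
  rcases Nat.even_or_odd m with hm | hm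
  · have h := PSF.add_inv_mul F G
    rw [show PSF.map SF.inv F = F by simpa [PSF.HasParity, hm.neg_one_pow] using hF] at h
    rw [(hm.mul_right n).neg_one_pow, one_smul, two_smul, two_smul, ← add_mul, h, mul_add]
  · have h := PSF.sub_inv_mul F G
    rw [show PSF.map SF.inv F = -F by simpa [PSF.HasParity, hm.neg_one_pow] using hF, sub_neg_eq_add, hG] at h
    rw [pow_mul, hm.neg_one_pow, smul_comm, two_smul, two_smul, ← add_mul, h, smul_mul_assoc,
      mul_add]

theorem PSF.HasParity.mul_self_of_odd {F : PSF B U κ} (hF : PSF.HasParity 1 F) : F * F = 0 := by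
  refine (isUnit_two (B := B)).smul_left_cancel.1 ?_
  have h := hF.mul_comm hF
  rw [smul_zero, two_smul]
  nth_rw 1 [h]
  simp

end Parameters

/-! ### The canonical Poisson bracket -/

section PoissonBracket

variable {ι κ : Type} [Fintype ι] [DecidableEq ι] [Fintype κ] [DecidableEq κ]
  {B : Type v} [CommRing B] [Algebra ℝ B] {U : Opens (ι → ℝ)}

theorem deg_posIdx (A : ι ⊕ κ) : deg (posIdx A) = deg A := by rcases A with a | j <;> rfl

theorem deg_momIdx (A : ι ⊕ κ) : deg (momIdx A) = deg A := by rcases A with a | j <;> rfl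

theorem poisson_add_left (F F' G : PSF B (cot U) (κ ⊕ κ)) :
    poisson (F + F') G = poisson F G + poisson F' G := by
  simp only [poisson, ← Finset.sum_add_distrib]
  refine Finset.sum_congr rfl fun A _ => ?_
  rw [PSF.twist_add, map_add, map_add, add_mul, add_mul, smul_add]
  abel

theorem poisson_add_right (F G G' : PSF B (cot U) (κ ⊕ κ)) :
    poisson F (G + G') = poisson F G + poisson F G' := by
  simp only [poisson, ← Finset.sum_add_distrib]
  refine Finset.sum_congr rfl fun A _ => ?_
  rw [map_add, map_add, mul_add, mul_add, smul_add]
  abel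

theorem poisson_smul_left (b : B) (F G : PSF B (cot U) (κ ⊕ κ)) :
    poisson (b • F) G = b • poisson F G := by
  simp only [poisson, Finset.smul_sum]
  refine Finset.sum_congr rfl fun A _ => ?_
  rw [PSF.twist_smul, map_smul, map_smul, smul_mul_assoc, smul_mul_assoc, smul_sub, smul_comm]

theorem poisson_smul_right (b : B) (F G : PSF B (cot U) (κ ⊕ κ)) :
    poisson F (b • G) = b • poisson F G := by
  simp only [poisson, Finset.smul_sum]
  refine Finset.sum_congr rfl fun A _ => ?_
  rw [map_smul, map_smul, mul_smul_comm, mul_smul_comm, smul_sub, smul_comm]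

/-- The canonical Poisson bracket with a homogeneous function in the first argument. -/
theorem PSF.HasParity.poisson_eq {m : ℕ} {F : PSF B (cot U) (κ ⊕ κ)} (hF : PSF.HasParity m F)
    (G : PSF B (cot U) (κ ⊕ κ)) :
    poisson F G = ∑ A : ι ⊕ κ,
      ((-1 : B) ^ (deg A + deg A * m) •
          (PSF.partialDeriv (momIdx A) F * PSF.partialDeriv (posIdx A) G)
        - (-1 : B) ^ (deg A * m) •
          (PSF.partialDeriv (posIdx A) F * PSF.partialDeriv (momIdx A) G)) := by
  refine Finset.sum_congr rfl fun A _ => ?_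
  rw [hF.twist A, map_smul, map_smul, smul_mul_assoc, smul_mul_assoc, smul_smul, ← pow_add]

theorem PSF.HasParity.partialDeriv_mul {n : ℕ} {G : PSF B U κ}
    (hG : PSF.HasParity n G) (A : ι ⊕ κ) (H : PSF B U κ) :
    PSF.partialDeriv A (G * H) =
      PSF.partialDeriv A G * H + (-1 : B) ^ (deg A * n) • (G * PSF.partialDeriv A H) := by
  rw [PSF.partialDeriv_mul, hG.twist, smul_mul_assoc]

/-- The graded Leibniz rule `{F, GH} = {F, G} H + (-1)^{|F||G|} G {F, H}`. -/
theorem poisson_mul_right {m n : ℕ} {F G : PSF B (cot U) (κ ⊕ κ)} (hF : PSF.HasParity m F)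
    (hG : PSF.HasParity n G) (H : PSF B (cot U) (κ ⊕ κ)) :
    poisson F (G * H) = poisson F G * H + (-1 : B) ^ (m * n) • (G * poisson F H) := by
  rw [hF.poisson_eq, hF.poisson_eq, hF.poisson_eq, Finset.sum_mul, Finset.mul_sum,
    Finset.smul_sum, ← Finset.sum_add_distrib]
  refine Finset.sum_congr rfl fun A _ => ?_
  -- Moving `G` to the left past a derivative of `F` along a coordinate of parity `|A|`.
  have key (C : (ι ⊕ ι) ⊕ (κ ⊕ κ)) (hC : deg C = deg A) (K : PSF B (cot U) (κ ⊕ κ)) :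
      PSF.partialDeriv C F * ((-1 : B) ^ (deg A * n) • (G * K)) =
        (-1 : B) ^ (m * n) • (G * (PSF.partialDeriv C F * K)) := by
    rw [mul_smul_comm, ← mul_assoc, (hF.partialDeriv C).mul_comm hG, smul_mul_assoc, smul_smul,
      ← pow_add, mul_assoc, hC]
    congr 1
    exact neg_one_pow_congr (by simp only [Nat.even_add, Nat.even_mul]; tauto)
  rw [hG.partialDeriv_mul, hG.partialDeriv_mul, deg_posIdx, deg_momIdx, mul_add, mul_add,
    key _ (deg_momIdx A), key _ (deg_posIdx A)]
  simp only [sub_mul, mul_sub, smul_mul_assoc, mul_smul_comm, smul_add, smul_sub, mul_assoc]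
  rw [smul_comm ((-1 : B) ^ (m * n)), smul_comm ((-1 : B) ^ (m * n))]
  abel

/-- Graded antisymmetry `{F, G} = -(-1)^{|F||G|} {G, F}`. -/
theorem poisson_comm {m n : ℕ} {F G : PSF B (cot U) (κ ⊕ κ)} (hF : PSF.HasParity m F)
    (hG : PSF.HasParity n G) : poisson F G = -((-1 : B) ^ (m * n) • poisson G F) := by
  rw [hF.poisson_eq, hG.poisson_eq, Finset.smul_sum, ← Finset.sum_neg_distrib]
  refine Finset.sum_congr rfl fun A _ => ?_
  rw [(hF.partialDeriv (momIdx A)).mul_comm (hG.partialDeriv (posIdx A)),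
    (hF.partialDeriv (posIdx A)).mul_comm (hG.partialDeriv (momIdx A)),
    deg_posIdx, deg_momIdx, smul_sub, neg_sub]
  simp only [smul_smul, ← pow_add]
  congr 2
  · exact neg_one_pow_congr (by simp only [Nat.even_add, Nat.even_mul]; tauto)
  · exact neg_one_pow_congr (by simp only [Nat.even_add, Nat.even_mul]; tauto)

/-! ### Symbols of vector fields -/

theorem mom_hasParity (A : ι ⊕ κ) :
    PSF.HasParity (deg A) (mom A : PSF B (cot U) (κ ⊕ κ)) := by
  rw [PSF.HasParity, mom, PSF.map_const, SF.inv_coord, deg_momIdx]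
  rcases A with a | j
  · simp [deg]
  · simpa [deg, PSF.const_eq] using PSF.mk_neg (1 : B) _

theorem PSF.partialDeriv_posIdx_lift (A : ι ⊕ κ) (F : PSF B U κ) :
    PSF.partialDeriv (posIdx A) (PSF.map SF.lift F) = PSF.map SF.lift (PSF.partialDeriv A F) := by
  induction F using PSF.induction with
  | add F F' hF hF' => simp only [map_add, hF, hF']
  | mk b f =>
    simp only [PSF.map_mk, PSF.partialDeriv_mk, SF.partialDeriv_posIdx_lift]

theorem PSF.partialDeriv_momIdx_lift (A : ι ⊕ κ) (F : PSF B U κ) :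
    PSF.partialDeriv (momIdx A) (PSF.map SF.lift F) = 0 := by
  induction F using PSF.induction with
  | add F F' hF hF' => simp only [map_add, hF, hF', add_zero]
  | mk b f =>
    simp only [PSF.map_mk, PSF.partialDeriv_mk, SF.partialDeriv_momIdx_lift, PSF.mk_zero]

theorem PSF.HasParity.lift {n : ℕ} {F : PSF B U κ} (hF : PSF.HasParity n F) :
    PSF.HasParity n (PSF.map SF.lift F) := by
  rw [PSF.HasParity] at hF ⊢
  rw [← map_smul, ← hF, PSF.map_map, PSF.map_map]
  congr 2
  exact AlgHom.ext SF.inv_lift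

theorem PSF.partialDeriv_coord (A C : ι ⊕ κ) :
    PSF.partialDeriv A (PSF.const (SF.coord C) : PSF B U κ) = if C = A then 1 else 0 := by
  rw [PSF.partialDeriv_const, SF.partialDeriv_coord]
  split_ifs
  · rfl
  · exact PSF.mk_zero 1

theorem partialDeriv_posIdx_mom (A C : ι ⊕ κ) :
    PSF.partialDeriv (posIdx A) (mom C : PSF B (cot U) (κ ⊕ κ)) = 0 := by
  rw [mom, PSF.partialDeriv_coord, if_neg]
  rcases A with a | j <;> rcases C with b | k <;> simp [posIdx, momIdx]

theorem partialDeriv_momIdx_mom (A C : ι ⊕ κ) :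
    PSF.partialDeriv (momIdx A) (mom C : PSF B (cot U) (κ ⊕ κ)) = if C = A then 1 else 0 := by
  rw [mom, PSF.partialDeriv_coord]
  rcases A with a | j <;> rcases C with b | k <;> simp [momIdx]

theorem act_coord (X : ι ⊕ κ → PSF B U κ) (A : ι ⊕ κ) :
    act X (PSF.const (SF.coord A)) = X A := by
  simp [act, PSF.partialDeriv_coord]

theorem symb_smul (b : B) (X : ι ⊕ κ → PSF B U κ) : symb (b • X) = b • symb X := by
  simp [symb, Finset.smul_sum]

theorem partialDeriv_posIdx_symb (X : ι ⊕ κ → PSF B U κ) (A : ι ⊕ κ) :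
    PSF.partialDeriv (posIdx A) (symb X) =
      ∑ C, PSF.map SF.lift (PSF.partialDeriv A (X C)) * mom C := by
  rw [symb, map_sum]
  refine Finset.sum_congr rfl fun C _ => ?_
  rw [PSF.partialDeriv_mul, partialDeriv_posIdx_mom, mul_zero, add_zero,
    PSF.partialDeriv_posIdx_lift]

theorem partialDeriv_momIdx_symb {m : ℕ} {X : ι ⊕ κ → PSF B U κ}
    (hX : ∀ A, PSF.HasParity (m + deg A) (X A)) (A : ι ⊕ κ) :
    PSF.partialDeriv (momIdx A) (symb X) =
      (-1 : B) ^ (deg A * (m + deg A)) • PSF.map SF.lift (X A) := by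
  rw [symb, map_sum, Finset.sum_eq_single A]
  · rw [(hX A).lift.partialDeriv_mul, PSF.partialDeriv_momIdx_lift, partialDeriv_momIdx_mom,
      if_pos rfl, zero_mul, zero_add, mul_one, deg_momIdx]
  · intro C _ hC
    rw [PSF.partialDeriv_mul, PSF.partialDeriv_momIdx_lift, partialDeriv_momIdx_mom,
      if_neg hC, zero_mul, zero_add, mul_zero]
  · simp

theorem symb_hasParity {m : ℕ} {X : ι ⊕ κ → PSF B U κ}
    (hX : ∀ A, PSF.HasParity (m + deg A) (X A)) : PSF.HasParity m (symb X) :=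
  PSF.HasParity.sum fun A _ => ((hX A).lift.mul (mom_hasParity A)).congr
    (by simp only [Nat.even_add]; tauto)

/-- The Poisson bracket of two symbols is the symbol of the graded commutator. -/
theorem poisson_symb_symb {m n : ℕ} {X Y : ι ⊕ κ → PSF B U κ}
    (hX : ∀ A, PSF.HasParity (m + deg A) (X A)) (hY : ∀ A, PSF.HasParity (n + deg A) (Y A)) :
    poisson (symb X) (symb Y) =
      symb fun C => act X (Y C) - (-1 : B) ^ (m * n) • act Y (X C) := by
  rw [(symb_hasParity hX).poisson_eq]
  simp only [partialDeriv_posIdx_symb, partialDeriv_momIdx_symb hX, partialDeriv_momIdx_symb hY]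
  simp only [act, symb, map_sub, map_smul, map_sum, map_mul, sub_mul, Finset.sum_mul, Finset.mul_sum,
    Finset.smul_sum, Finset.sum_sub_distrib, smul_mul_assoc, mul_smul_comm, smul_smul]
  rw [Finset.sum_comm]
  congr 1
  · refine Finset.sum_congr rfl fun C _ => Finset.sum_congr rfl fun A _ => ?_
    rw [← pow_add, mul_assoc, Even.neg_one_pow, one_smul]
    simp only [Nat.even_add, Nat.even_mul]; tauto
  · rw [Finset.sum_comm]
    refine Finset.sum_congr rfl fun C _ => Finset.sum_congr rfl fun A _ => ?_
    rw [mul_assoc, (mom_hasParity C).mul_comm (hY A).lift, mul_smul_comm, ← mul_assoc,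
      (((hX C).partialDeriv A).lift).mul_comm (hY A).lift, smul_mul_assoc, smul_smul, smul_smul,
      ← pow_add, ← pow_add, ← pow_add]
    congr 1
    exact neg_one_pow_congr (by simp only [Nat.even_add, Nat.even_mul]; tauto)

end PoissonBracket

/-! ### Extension of parameters -/

section Extension

variable {ι κ ι' κ' : Type} [Fintype ι] [Fintype ι'] [DecidableEq ι] [Fintype κ] [DecidableEq κ]
  {B : Type v} [CommRing B] [Algebra ℝ B] {U : Opens (ι → ℝ)} {U' : Opens (ι' → ℝ)}

variable (B) in
/-- Extension of parameters from `ℝ` to `B` as a ring homomorphism. -/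
def PSF.extendHom : PSF ℝ U κ →+* PSF B U κ :=
  (Algebra.TensorProduct.map (Algebra.ofId ℝ B) (AlgHom.id ℝ (SF U κ)) :
    ℝ ⊗[ℝ] SF U κ →ₐ[ℝ] B ⊗[ℝ] SF U κ).toRingHom

theorem PSF.extend_eq (F : PSF ℝ U κ) : PSF.extend B F = PSF.extendHom B F := rfl

theorem PSF.extendHom_mk (r : ℝ) (F : SF U κ) :
    PSF.extendHom B (PSF.mk r F) = PSF.mk (algebraMap ℝ B r) F := rfl

theorem PSF.extendHom_const (F : SF U κ) :
    PSF.extendHom B (PSF.const F) = PSF.const F := by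
  rw [PSF.const_eq, PSF.extendHom_mk, map_one, PSF.const_eq]

theorem PSF.mk_eq_smul_extendHom (b : B) (F : SF U κ) :
    PSF.mk b F = b • PSF.extendHom B (PSF.const F) := by
  rw [PSF.extendHom_const, PSF.const_eq, PSF.smul_mk, mul_one]

theorem PSF.extendHom_smul (r : ℝ) (F : PSF ℝ U κ) :
    PSF.extendHom B (r • F) = algebraMap ℝ B r • PSF.extendHom B F := by
  induction F using PSF.induction with
  | add F F' hF hF' => simp only [map_add, smul_add, hF, hF']
  | mk b f => simp only [PSF.smul_mk, PSF.extendHom_mk, map_mul]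

theorem PSF.extendHom_map (φ : SF U κ →ₐ[ℝ] SF U' κ') (F : PSF ℝ U κ) :
    PSF.extendHom B (PSF.map φ F) = PSF.map φ (PSF.extendHom B F) := by
  induction F using PSF.induction with
  | add F F' hF hF' => simp only [map_add, hF, hF']
  | mk b f => simp only [PSF.map_mk, PSF.extendHom_mk]

theorem PSF.extendHom_partialDeriv (A : ι ⊕ κ) (F : PSF ℝ U κ) :
    PSF.extendHom B (PSF.partialDeriv A F) = PSF.partialDeriv A (PSF.extendHom B F) := by
  induction F using PSF.induction with
  | add F F' hF hF' => simp only [map_add, hF, hF']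
  | mk b f => simp only [PSF.partialDeriv_mk, PSF.extendHom_mk]

theorem PSF.extendHom_twist {α β : Type} (A : α ⊕ β) (F : PSF ℝ U κ) :
    PSF.extendHom B (PSF.twist A F) = PSF.twist A (PSF.extendHom B F) := by
  rcases A with a | j
  · rfl
  · exact PSF.extendHom_map _ _

theorem PSF.HasParity.extend {n : ℕ} {F : PSF ℝ U κ} (hF : PSF.HasParity n F) :
    PSF.HasParity n (PSF.extend B F) := by
  rw [PSF.HasParity] at hF ⊢
  rw [PSF.extend_eq, ← PSF.extendHom_map, hF, PSF.extendHom_smul]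
  simp

theorem PSF.extendHom_mom (A : ι ⊕ κ) :
    PSF.extendHom B (mom A : PSF ℝ (cot U) (κ ⊕ κ)) = mom A :=
  PSF.extendHom_const _

theorem poisson_extend (F G : PSF ℝ (cot U) (κ ⊕ κ)) :
    poisson (PSF.extend B F) (PSF.extend B G) = PSF.extend B (poisson F G) := by
  simp only [PSF.extend_eq, poisson, map_sum, map_sub, map_mul, PSF.extendHom_smul, map_pow,
    map_neg, map_one, PSF.extendHom_partialDeriv, PSF.extendHom_twist]

theorem act_extend (X : ι ⊕ κ → PSF ℝ U κ) (f : PSF ℝ U κ) :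
    act (fun A => PSF.extend B (X A)) (PSF.extend B f) = PSF.extend B (act X f) := by
  simp only [PSF.extend_eq, act, map_sum, map_mul, PSF.extendHom_partialDeriv]

theorem symb_extend (X : ι ⊕ κ → PSF ℝ U κ) :
    symb (fun A => PSF.extend B (X A)) = PSF.extend B (symb X) := by
  simp only [PSF.extend_eq, symb, map_sum, map_mul, PSF.extendHom_map, PSF.extendHom_mom]

theorem DegreeTwo.extend {F : PSF ℝ (cot U) (κ ⊕ κ)} (hF : DegreeTwo F) :
    DegreeTwo (PSF.extend B F) := by
  obtain ⟨f, rfl⟩ := hF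
  refine ⟨fun A C => PSF.extend B (f A C), ?_⟩
  simp only [PSF.extend_eq, map_sum, map_mul, PSF.extendHom_map, PSF.extendHom_mom]

theorem act_add_right (X : ι ⊕ κ → PSF B U κ) (f g : PSF B U κ) :
    act X (f + g) = act X f + act X g := by
  simp only [act, map_add, mul_add, Finset.sum_add_distrib]

theorem act_smul_right (b : B) (X : ι ⊕ κ → PSF B U κ) (f : PSF B U κ) :
    act X (b • f) = b • act X f := by
  simp only [act, map_smul, mul_smul_comm, Finset.smul_sum]

theorem act_smul_left (b : B) (X : ι ⊕ κ → PSF B U κ) (f : PSF B U κ) :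
    act (b • X) f = b • act X f := by
  simp only [act, Pi.smul_apply, smul_mul_assoc, Finset.smul_sum]

end Extension

/-! ### Functions of degree two -/

section DegreeTwo

variable {ι κ : Type} [Fintype ι] [DecidableEq ι] [Fintype κ] [DecidableEq κ]
  {B : Type v} [CommRing B] [Algebra ℝ B] {U : Opens (ι → ℝ)}

theorem DegreeTwo.add {F G : PSF B (cot U) (κ ⊕ κ)} (hF : DegreeTwo F) (hG : DegreeTwo G) :
    DegreeTwo (F + G) := by
  obtain ⟨f, rfl⟩ := hF
  obtain ⟨g, rfl⟩ := hG
  refine ⟨fun A C => f A C + g A C, ?_⟩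
  simp only [map_add, add_mul, Finset.sum_add_distrib]

theorem DegreeTwo.smul {F : PSF B (cot U) (κ ⊕ κ)} (hF : DegreeTwo F) (b : B) :
    DegreeTwo (b • F) := by
  obtain ⟨f, rfl⟩ := hF
  refine ⟨fun A C => b • f A C, ?_⟩
  simp only [map_smul, smul_mul_assoc, Finset.smul_sum]

theorem degreeTwo_symb_mul_symb {n : ℕ} (X : ι ⊕ κ → PSF B U κ) {Y : ι ⊕ κ → PSF B U κ}
    (hY : ∀ A, PSF.HasParity (n + deg A) (Y A)) : DegreeTwo (symb X * symb Y) := by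
  refine ⟨fun A C => (-1 : B) ^ (deg A * (n + deg C)) • (X A * Y C), ?_⟩
  simp only [symb, Finset.sum_mul_sum, map_smul, map_mul]
  refine Finset.sum_congr rfl fun A _ => Finset.sum_congr rfl fun C _ => ?_
  rw [mul_assoc, ← mul_assoc (mom A), (mom_hasParity A).mul_comm (hY C).lift]
  simp only [smul_mul_assoc, mul_smul_comm, mul_assoc]

end DegreeTwo

/-! ### Changes of coordinates -/

section CoordinateChange

variable {ι κ : Type} [Fintype ι] [DecidableEq ι] [Fintype κ] [DecidableEq κ]
  {B : Type v} [CommRing B] [Algebra ℝ B] {U V : Opens (ι → ℝ)}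

theorem map_res_symb (h : V ≤ U) (X : ι ⊕ κ → PSF B U κ) :
    PSF.map (SF.res (cot_mono h)) (symb X) = symb fun A => PSF.map (SF.res h) (X A) := by
  simp only [symb, map_sum, map_mul]
  refine Finset.sum_congr rfl fun A _ => ?_
  rw [mom, PSF.map_const, SF.res_coord, ← mom, PSF.map_map, PSF.map_map]
  exact congrArg (fun φ => PSF.map φ (X A) * mom A) (AlgHom.ext (SF.res_lift h))

/-- The cotangent lift of a change of coordinates takes the symbol of a vector field to the symbol
of the transformed vector field. -/
theorem IsCotangentLift.map_symb {ψ : SF V κ ≃ₐ[ℝ] SF U κ} {Ψ : CSF V κ →ₐ[ℝ] CSF U κ}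
    (h : IsCotangentLift ψ Ψ) (X : ι ⊕ κ → PSF B V κ) :
    PSF.map Ψ (symb X) =
      symb fun A => PSF.map ψ.toAlgHom (act X (PSF.const (ψ.symm (SF.coord A)))) := by
  have hlift (F : PSF B V κ) :
      PSF.map Ψ (PSF.map SF.lift F) = PSF.map SF.lift (PSF.map ψ.toAlgHom F) := by
    rw [PSF.map_map, PSF.map_map]
    exact congrArg (fun φ => PSF.map φ F) (AlgHom.ext h.1)
  have hmom (A : ι ⊕ κ) : PSF.map Ψ (mom A : PSF B (cot V) (κ ⊕ κ)) = ∑ C : ι ⊕ κ,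
      PSF.map SF.lift (PSF.map ψ.toAlgHom
        (PSF.partialDeriv A (PSF.const (ψ.symm (SF.coord C))))) * mom C := by
    rw [mom, PSF.map_const, h.2]
    refine (TensorProduct.tmul_sum _ _ _).trans (Finset.sum_congr rfl fun C _ => ?_)
    exact (congrArg (PSF.mk · _) (mul_one (1 : B)).symm).trans (PSF.mk_mul_mk _ _ _ _).symm
  simp only [symb, act, map_sum, map_mul, hlift, hmom, Finset.mul_sum, Finset.sum_mul, mul_assoc]
  exact Finset.sum_comm

end CoordinateChange

/-! ### Structures on supermanifolds -/

section Structures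

variable {p q : ℕ} {M : Supermanifold.{u} p q} {B : Type v} [CommRing B] [Algebra ℝ B]

theorem IsHomological.smul {Q : VecFamily B M} (hQ : IsHomological Q) (b : B) :
    IsHomological (b • Q) where
  isVectorField c d A := by
    have h : (fun C => PSF.map (SF.res (overlap_le_right c d)) ((b • Q) d C)) =
        b • fun C => PSF.map (SF.res (overlap_le_right c d)) (Q d C) :=
      funext fun C => map_smul _ b (Q d C)
    rw [h, act_smul_left, map_smul, hQ.isVectorField c d A]
    exact (map_smul _ b (Q c A)).symm
  odd c A := (hQ.odd c A).smul b
  sq_zero c f := by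
    rw [Pi.smul_apply, act_smul_left, act_smul_left, act_smul_right, hQ.sq_zero, smul_zero,
      smul_zero]

theorem IsAlmostSchouten.smul {S : CotFamily B M} (hS : IsAlmostSchouten S) (a : B) :
    IsAlmostSchouten (a • S) where
  isCotFunction c d := by
    obtain ⟨Ψ, hΨ, h⟩ := hS.isCotFunction c d
    refine ⟨Ψ, hΨ, ?_⟩
    simp only [Pi.smul_apply, map_smul, h]
  odd c := (hS.odd c).smul a
  degreeTwo c := (hS.degreeTwo c).smul a

theorem IsAlmostSchouten.add_smul_symbol_mul_symbol {S : CotFamily B M} {E Q : VecFamily B M}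
    (hS : IsAlmostSchouten S) (hE : IsVectorField E) (hE' : VecHasParity 0 E)
    (hQ : IsVectorField Q) (hQ' : VecHasParity 1 Q) (b : B) :
    IsAlmostSchouten (S + b • (symbol E * symbol Q)) where
  isCotFunction c d := by
    -- The cotangent lift that transforms `S` also transforms the symbols of vector fields.
    obtain ⟨Ψ, hΨ, h⟩ := hS.isCotFunction c d
    refine ⟨Ψ, hΨ, ?_⟩
    have hsymb {X : VecFamily B M} (hX : IsVectorField X) :
        PSF.map Ψ (PSF.map (SF.res (cot_mono (overlap_le_right c d))) (symbol X d)) =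
          PSF.map (SF.res (cot_mono (overlap_le_left c d))) (symbol X c) := by
      rw [symbol, map_res_symb (overlap_le_right c d), symbol,
        map_res_symb (overlap_le_left c d), hΨ.map_symb]
      exact congrArg symb (funext (hX c d))
    simp only [Pi.add_apply, Pi.smul_apply, Pi.mul_apply, map_add, map_smul, map_mul, h, hsymb hE,
      hsymb hQ]
  odd c := (hS.odd c).add (((symb_hasParity (hE' c)).mul (symb_hasParity (hQ' c))).smul b)
  degreeTwo c := (hS.degreeTwo c).add ((degreeTwo_symb_mul_symb _ (hQ' c)).smul b)

/-- An exact QS structure stays one after extension of parameters. -/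
theorem IsExactQS.extend (B : Type v) [CommRing B] [Algebra ℝ B] {S : CotFamily ℝ M}
    {Q E : VecFamily ℝ M} (h : IsExactQS S Q E) :
    IsExactQS (CotFamily.extend B S) (VecFamily.extend B Q) (VecFamily.extend B E) := by
  have hvec {X : VecFamily ℝ M} (hX : IsVectorField X) :
      IsVectorField (VecFamily.extend B X) := fun c d A => by
    have := congrArg (PSF.extend B) (hX c d A)
    simp only [PSF.extend_eq, PSF.extendHom_map, act, map_sum, map_mul,
      PSF.extendHom_partialDeriv, PSF.extendHom_const] at this
    simpa only [act, map_sum, map_mul, VecFamily.extend, PSF.extend_eq] using this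
  have hsymb (X : VecFamily ℝ M) :
      symbol (VecFamily.extend B X) = CotFamily.extend B (symbol X) :=
    funext fun c => symb_extend (X c)
  have hpb (F G : CotFamily ℝ M) :
      pb (CotFamily.extend B F) (CotFamily.extend B G) = CotFamily.extend B (pb F G) :=
    funext fun c => poisson_extend (F c) (G c)
  have hzero : CotFamily.extend B (0 : CotFamily ℝ M) = 0 :=
    funext fun c => map_zero (PSF.extendHom B)
  refine
    { isSchouten :=
        { isCotFunction := fun c d => ?_
          odd := fun c => (h.isSchouten.odd c).extend
          degreeTwo := fun c => (h.isSchouten.degreeTwo c).extend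
          schouten := by rw [hpb, h.isSchouten.schouten, hzero] }
      isHomological :=
        { isVectorField := hvec h.isHomological.isVectorField
          odd := fun c A => (h.isHomological.odd c A).extend
          sq_zero := fun c f => ?_ }
      invariant := by rw [hsymb, hpb, h.invariant, hzero]
      isVectorField := hvec h.isVectorField
      even := fun c A => (h.even c A).extend
      lie_S := by
        rw [hsymb, hpb, h.lie_S]
        exact funext fun c => map_neg (PSF.extendHom B) (S c)
      lie_Q := fun c f => ?_ }
  · obtain ⟨Ψ, hΨ, hS⟩ := h.isSchouten.isCotFunction c d
    refine ⟨Ψ, hΨ, ?_⟩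
    have := congrArg (PSF.extend B) hS
    simpa only [CotFamily.extend, PSF.extend_eq, PSF.extendHom_map] using this
  · induction f using PSF.induction with
    | add f g hf hg => rw [act_add_right, act_add_right, hf, hg, add_zero]
    | mk b f =>
      rw [PSF.mk_eq_smul_extendHom, ← PSF.extend_eq, act_smul_right, act_smul_right]
      unfold VecFamily.extend
      rw [act_extend, act_extend, h.isHomological.sq_zero, PSF.extend_eq, map_zero, smul_zero]
  · induction f using PSF.induction with
    | add f g hf hg =>
      simp only [act_add_right] at hf hg ⊢
      rw [add_sub_add_comm, hf, hg, neg_add]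
    | mk b f =>
      simp only [PSF.mk_eq_smul_extendHom, ← PSF.extend_eq, act_smul_right]
      unfold VecFamily.extend
      simp only [act_extend]
      rw [← smul_sub, ← smul_neg]
      simp only [PSF.extend_eq]
      rw [← map_sub, ← map_neg, h.lie_Q]

end Structures

/-! ### The odd Jacobi structures of an exact QS structure -/

section BracketComputation

variable {ι κ : Type} [Fintype ι] [DecidableEq ι] [Fintype κ] [DecidableEq κ]
  {B : Type v} [CommRing B] [Algebra ℝ B] {U : Opens (ι → ℝ)}
  {s e t : PSF B (cot U) (κ ⊕ κ)}

/-- If `{t, e} = t` and `{t, t} = 0` for an even `e` and an odd `t`, then `{t, e t} = t² = 0`. -/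
theorem poisson_odd_even_mul_odd (he : PSF.HasParity 0 e) (ht : PSF.HasParity 1 t)
    (hte : poisson t e = t) (htt : poisson t t = 0) : poisson t (e * t) = 0 := by
  rw [poisson_mul_right ht he, hte, htt, ht.mul_self_of_odd]
  simp

/-- The bracket `{a s + b e t, a s + b e t} = -2 (b t) (a s + b e t)`, from the brackets of the
odd functions `s`, `t` and the even function `e`. -/
theorem poisson_self_add_mul (hs : PSF.HasParity 1 s) (he : PSF.HasParity 0 e)
    (ht : PSF.HasParity 1 t) (hss : poisson s s = 0) (hts : poisson t s = 0)
    (htt : poisson t t = 0) (hes : poisson e s = -s) (het : poisson e t = -t) (a b : B) :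
    poisson (a • s + b • (e * t)) (a • s + b • (e * t)) =
      (-2 : B) • ((b • t) * (a • s + b • (e * t))) := by
  have het' : PSF.HasParity 1 (e * t) := (he.mul ht).congr (by rw [zero_add])
  have h_te : poisson t e = t := by rw [poisson_comm ht he, het]; simp
  have h_se : poisson s e = s := by rw [poisson_comm hs he, hes]; simp
  have h_st : poisson s t = 0 := by rw [poisson_comm hs ht, hts]; simp
  have h_tt : t * t = 0 := ht.mul_self_of_odd
  have h_t_et : poisson t (e * t) = 0 := poisson_odd_even_mul_odd he ht h_te htt
  have h_s_et : poisson s (e * t) = s * t := by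
    rw [poisson_mul_right hs he, h_se, h_st]; simp
  have h_et_s : poisson (e * t) s = s * t := by
    rw [poisson_comm het' hs, h_s_et]; simp
  have h_et_t : poisson (e * t) t = 0 := by
    rw [poisson_comm het' ht, h_t_et]; simp
  -- `{e t, e t} = {e t, e} t`, and both terms of `{e t, e} = e t - {e, e} t` have a factor `t`.
  have h_et_et : poisson (e * t) (e * t) = 0 := by
    rw [poisson_mul_right het' he, h_et_t, poisson_comm het' he, poisson_mul_right he he, het]
    simp [add_mul, mul_assoc, h_tt]
  have h_ts : t * s = -(s * t) := by rw [ht.mul_comm hs]; simp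
  have h_t_e_t : t * (e * t) = 0 := by
    rw [← mul_assoc, ht.mul_comm he, smul_mul_assoc, mul_assoc, h_tt]
    simp
  simp only [poisson_add_left, poisson_add_right, poisson_smul_left, poisson_smul_right, hss,
    h_s_et, h_et_s, h_et_et, mul_add, smul_mul_smul_comm, h_ts, h_t_e_t]
  module

end BracketComputation

section Structures

variable {p q : ℕ} {M : Supermanifold.{u} p q} {B : Type v} [CommRing B] [Algebra ℝ B]
  {S : CotFamily B M} {Q E : VecFamily B M}

theorem symbol_smul (b : B) (X : VecFamily B M) : symbol (b • X) = b • symbol X :=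
  funext fun c => symb_smul b (X c)

theorem IsHomological.poisson_symb_self (hQ : IsHomological Q) (c : M.Charts) :
    poisson (symb (Q c)) (symb (Q c)) = 0 := by
  have h (A) : act (Q c) (Q c A) = 0 := by
    rw [← act_coord (Q c) A, hQ.sq_zero]
  rw [poisson_symb_symb (hQ.odd c) (hQ.odd c)]
  simp [symb, h]

theorem IsExactQS.poisson_symb_symb (h : IsExactQS S Q E) (c : M.Charts) :
    poisson (symb (E c)) (symb (Q c)) = -symb (Q c) := by
  have hEQ (A) : act (E c) (Q c A) - act (Q c) (E c A) = -Q c A := by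
    have := h.lie_Q c (PSF.const (SF.coord A))
    rwa [act_coord, act_coord] at this
  rw [OddJacobi.poisson_symb_symb (h.even c) (h.isHomological.odd c)]
  simp [symb, hEQ]

theorem IsExactQS.isOddJacobi (h : IsExactQS S Q E) (a b : B) :
    IsOddJacobi (a • S + b • (symbol E * symbol Q)) (b • Q) where
  isAlmostSchouten := (h.isSchouten.toIsAlmostSchouten.smul a).add_smul_symbol_mul_symbol
    h.isVectorField h.even h.isHomological.isVectorField h.isHomological.odd b
  isHomological := h.isHomological.smul b
  invariant := by
    funext c
    have he := symb_hasParity (h.even c)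
    have ht := symb_hasParity (h.isHomological.odd c)
    have hts : poisson (symb (Q c)) (S c) = 0 := congrFun h.invariant c
    have hte : poisson (symb (Q c)) (symb (E c)) = symb (Q c) := by
      rw [poisson_comm ht he, h.poisson_symb_symb]; simp
    rw [symbol_smul]
    change poisson (b • symb (Q c)) (a • S c + b • (symb (E c) * symb (Q c))) = 0
    rw [poisson_smul_left, poisson_add_right, poisson_smul_right, poisson_smul_right, hts,
      poisson_odd_even_mul_odd he ht hte (h.isHomological.poisson_symb_self c)]
    simp
  compatible := by
    rw [symbol_smul]
    exact funext fun c => poisson_self_add_mul (h.isSchouten.odd c) (symb_hasParity (h.even c))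
      (symb_hasParity (h.isHomological.odd c)) (congrFun h.isSchouten.schouten c)
      (congrFun h.invariant c) (h.isHomological.poisson_symb_self c) (congrFun h.lie_S c)
      (h.poisson_symb_symb c) a b

theorem IsSchouten.smul (hS : IsSchouten S) (a : B) : IsSchouten (a • S) where
  toIsAlmostSchouten := hS.toIsAlmostSchouten.smul a
  schouten := by
    funext c
    change poisson (a • S c) (a • S c) = 0
    rw [poisson_smul_left, poisson_smul_right, show poisson (S c) (S c) = 0 from
      congrFun hS.schouten c, smul_zero, smul_zero]

end Structures

end OddJacobi

end

theorem mainTheorem2 {p q : ℕ} (M : OddJacobi.Supermanifold.{u} p q)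
    (S : OddJacobi.CotFamily ℝ M) (Q E : OddJacobi.VecFamily ℝ M)
    (h : OddJacobi.IsExactQS S Q E) :
    (∀ a b : ℝ, OddJacobi.IsOddJacobi
      (a • S + b • (OddJacobi.symbol E * OddJacobi.symbol Q)) (b • Q)) ∧
    (∀ (B : Type v) [CommRing B] [Algebra ℝ B] (a b : B), OddJacobi.IsOddJacobi
      (a • OddJacobi.CotFamily.extend B S +
        b • (OddJacobi.symbol (OddJacobi.VecFamily.extend B E) *
          OddJacobi.symbol (OddJacobi.VecFamily.extend B Q)))
      (b • OddJacobi.VecFamily.extend B Q)) ∧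
    (∀ a : ℝ, OddJacobi.IsSchouten (a • S) ∧ OddJacobi.IsOddJacobi (a • S) 0) ∧
    (∀ b : ℝ, OddJacobi.IsHomological (b • Q) ∧
      OddJacobi.IsOddJacobi (b • (OddJacobi.symbol E * OddJacobi.symbol Q)) (b • Q)) ∧
    OddJacobi.IsOddJacobi (S + OddJacobi.symbol E * OddJacobi.symbol Q) Q := by
  refine ⟨fun a b => h.isOddJacobi a b, fun B _ _ a b => (h.extend B).isOddJacobi a b,
    fun a => ⟨h.isSchouten.smul a, ?_⟩, fun b => ⟨h.isHomological.smul b, ?_⟩, ?_⟩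
  · simpa only [zero_smul, add_zero] using h.isOddJacobi a 0
  · simpa only [zero_smul, zero_add] using h.isOddJacobi 0 b
  · simpa only [one_smul] using h.isOddJacobi 1 1
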